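/- Let $G$ and $H$ be finite simple graphs that are subcubic, that is, $\Delta(G)\le 3$ and $\Delta(H)\le 3$, where $\Delta$ denotes the maximum degree. The corona $G\circ H$ is the graph obtained from one copy of $G$ and $|V(G)|$ disjoint copies of $H$, one copy $H_v$ for each vertex $v$ of $G$, by joining each vertex $v$ of $G$ to every vertex of $H_v$. For a positive integer $k$, a total $k$-coloring of a graph $F$ is a map $c: V(F)\cup E(F)\to\{1,\dots,k\}$ such that $c(x)\neq c(y)$ whenever $x$ and $y$ are adjacent vertices, distinct edges with a common end, or a vertex and an edge incident with it. For a vertex $u$, let $S(u)$ be the set consisting of $c(u)$ and the colors of all edges incident with $u$. The coloring is neighbor set-distinguishing if $S(u)\neq S(v)$ for every edge $uv$ of $F$, and $\mathrm{tndi}(F)$ is the smallest positive integer $k$ for which $F$ has a neighbor set-distinguishing total $k$-coloring. Then $$\mathrm{tndi}(G\circ H)\le \Delta(G\circ H)+3 .$$ -/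

import Mathlib

namespace SimpleGraph

/-- A finite simple graph is subcubic if its maximum degree is at most `3`. -/
def IsSubcubic {V : Type*} [Fintype V] (G : SimpleGraph V) [DecidableRel G.Adj] : Prop :=
  G.maxDegree ≤ 3

/-- Adjacency in the corona `G ∘ H`. The vertex `Sum.inl v` is the vertex `v` of the copy of `G`,
and `Sum.inr (v, w)` is the vertex `w` of the copy of `H` that belongs to `v`. -/
def CoronaAdj {V W : Type*} (G : SimpleGraph V) (H : SimpleGraph W) :
    V ⊕ V × W → V ⊕ V × W → Prop
  | Sum.inl v, Sum.inl v' => G.Adj v v'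
  | Sum.inl v, Sum.inr p => v = p.1
  | Sum.inr p, Sum.inl v => v = p.1
  | Sum.inr p, Sum.inr q => p.1 = q.1 ∧ H.Adj p.2 q.2

/-- The corona product `G ∘ H`: one copy of `G`, one copy of `H` for every vertex of `G`, and
every vertex of `G` joined to all the vertices of its copy of `H`. -/
def corona {V W : Type*} (G : SimpleGraph V) (H : SimpleGraph W) : SimpleGraph (V ⊕ V × W) where
  Adj := CoronaAdj G H
  symm := ⟨by
    rintro (v | p) (v' | q) h
    · exact G.adj_symm h
    · exact h
    · exact h
    · exact ⟨h.1.symm, H.adj_symm h.2⟩⟩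
  loopless := ⟨by
    rintro (v | p) h
    · exact G.irrefl h
    · exact H.irrefl h.2⟩

/-- Two elements of `V(G) ∪ E(G)` are in conflict if they are adjacent vertices, a vertex and an
edge incident with it, or two distinct edges with a common end. -/
def TotalConflict {V : Type*} (G : SimpleGraph V) : V ⊕ G.edgeSet → V ⊕ G.edgeSet → Prop
  | Sum.inl u, Sum.inl v => G.Adj u v
  | Sum.inl u, Sum.inr e => u ∈ (e : Sym2 V)
  | Sum.inr e, Sum.inl u => u ∈ (e : Sym2 V)
  | Sum.inr e, Sum.inr f => e ≠ f ∧ ∃ v, v ∈ (e : Sym2 V) ∧ v ∈ (f : Sym2 V)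

/-- `c` is a (proper) total coloring of `G` with colors in `{1, …, k}`. -/
def IsTotalColoring {V : Type*} (G : SimpleGraph V) (k : ℕ) (c : V ⊕ G.edgeSet → ℕ) : Prop :=
  (∀ x, c x ∈ Set.Icc 1 k) ∧ ∀ x y, G.TotalConflict x y → c x ≠ c y

/-- `S(u)`: the set of the colors of `u` and of the edges incident with `u`. -/
def colorSet {V : Type*} (G : SimpleGraph V) (c : V ⊕ G.edgeSet → ℕ) (u : V) : Set ℕ :=
  insert (c (Sum.inl u)) {a | ∃ e : G.edgeSet, u ∈ (e : Sym2 V) ∧ c (Sum.inr e) = a}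

/-- `c` is a neighbor set distinguishing total coloring of `G` with colors in `{1, …, k}`. -/
def IsNeighborSetDistinguishing {V : Type*} (G : SimpleGraph V) (k : ℕ)
    (c : V ⊕ G.edgeSet → ℕ) : Prop :=
  G.IsTotalColoring k c ∧ ∀ u v, G.Adj u v → G.colorSet c u ≠ G.colorSet c v

/-- `tndi(G)`: the least positive integer `k` such that `G` has a neighbor set distinguishing
total coloring with colors in `{1, …, k}` (and `⊤` if there is no such `k`). -/
noncomputable def tndi {V : Type*} (G : SimpleGraph V) : ℕ∞ :=
  ⨅ k ∈ {k : ℕ | 0 < k ∧ ∃ c, G.IsNeighborSetDistinguishing k c}, (k : ℕ∞)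

end SimpleGraph

/-! Let D be the maximum degree of G. If G has a vertex, a vertex of degree D gains |V(H)|
neighbours in the corona, so there are at least D + 3 + |V(H)| colors. The colors 1, …, D + 3 serve
G, and the others are given to the edges from each center to its copy by one injection `α`, the same
at every center. The color sets of adjacent centers then differ as soon as they differ in G, so two
tasks remain.

Coloring G with D + 3 colors (`exists_isDistinguishing`). Components that are K₄ get an explicit
coloring. Elsewhere Brooks' theorem gives a proper vertex coloring f with the values 1, 2, 3. Color
as many edges as possible properly with D further colors. As D ≤ 3, Kempe chains show that the
uncolored edges form a matching, so each can take the color of {1, 2, 3} that differs from both its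
ends. If adjacent u and v had equal sets, they would lie on uncolored edges ux and vy with f x = f y
the third color. Orient each uncolored edge from value i to value i + 1 modulo 3: one of u, v is
then a tail and the other a head. In this configuration u, x and v, y miss one color each, from the
same pair of colors. Kempe swaps make the smaller missing color lie at the tail on every uncolored
edge whose ends miss one color each, so u and v miss different colors
(`exists_partialEdgeColoring`).

Coloring the copies (`exists_isCopyColoring`). With at least three vertices in H, w gets the color
`α (σ w)` for a permutation σ without cycles of length 1 or 2, and edges use 1, 2, 3 and one fourth
color `α z`. The colors of `range α` seen at w then identify w well enough. Smaller copies use only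
1, 2, 3. -/

namespace SimpleGraph

/-! ### Brooks' theorem for maximum degree three -/

/-- Every vertex of `G` has at most `d` neighbours. -/
def DegLE {V : Type*} (G : SimpleGraph V) (d : ℕ) : Prop :=
  ∀ v (T : Finset V), (∀ w ∈ T, G.Adj v w) → T.card ≤ d

/-- `f` is a proper coloring of the subgraph of `G` induced by `S`. -/
def ProperOn {V C : Type*} (G : SimpleGraph V) (S : Set V) (f : V → C) : Prop :=
  ∀ u ∈ S, ∀ v ∈ S, G.Adj u v → f u ≠ f v

lemma exists_color_avoiding {V : Type*} {k : ℕ} (f : V → Fin k) (T : Finset V)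
    (hT : T.card < k) : ∃ c, ∀ w ∈ T, f w ≠ c := by
  classical
  have : (T.image f).card < (Finset.univ : Finset (Fin k)).card := by
    simpa using Finset.card_image_le.trans_lt hT
  obtain ⟨c, -, hc⟩ := Finset.exists_mem_notMem_of_card_lt_card this
  exact ⟨c, fun w hw h => hc (Finset.mem_image.2 ⟨w, hw, h⟩)⟩

/-- A proper coloring extends to one more vertex that has few colored neighbours. -/
lemma ProperOn.insert_vertex {V : Type*} [DecidableEq V] {k : ℕ} {G : SimpleGraph V} {S : Set V}
    {f : V → Fin k} (hf : G.ProperOn S f) (u : V) (c : Fin k)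
    (hc : ∀ w ∈ S, G.Adj u w → f w ≠ c) :
    G.ProperOn (insert u S) (Function.update f u c) := by
  intro x hx y hy hxy
  by_cases hxu : x = u
  · subst hxu
    have hyx : y ≠ x := hxy.ne'
    have hyS : y ∈ S := hy.resolve_left hyx
    simpa [hyx] using (hc y hyS hxy).symm
  · have hxS : x ∈ S := hx.resolve_left hxu
    by_cases hyu : y = u
    · subst hyu
      simpa [hxu] using hc x hxS hxy.symm
    · have hyS : y ∈ S := hy.resolve_left hyu
      simpa [hxu, hyu] using hf x hxS y hyS hxy

lemma ProperOn.mono {V C : Type*} {G : SimpleGraph V} {S T : Set V} {f : V → C}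
    (hf : G.ProperOn T f) (h : S ⊆ T) : G.ProperOn S f :=
  fun u hu v hv => hf u (h hu) v (h hv)

/-- A graph whose vertices have at most `d` neighbours is `(d + 1)`-colorable. -/
lemma DegLE.exists_properOn_univ {V : Type*} [Fintype V] {G : SimpleGraph V} {d : ℕ}
    (h : G.DegLE d) : ∃ f : V → Fin (d + 1), G.ProperOn Set.univ f := by
  classical
  suffices H : ∀ S : Finset V, ∃ f : V → Fin (d + 1), G.ProperOn (S : Set V) f by
    obtain ⟨f, hf⟩ := H Finset.univ
    exact ⟨f, hf.mono (by simp)⟩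
  intro S
  induction S using Finset.induction_on with
  | empty => exact ⟨fun _ => 0, by simp [ProperOn]⟩
  | insert u S hu ih =>
    obtain ⟨f, hf⟩ := ih
    obtain ⟨c, hc⟩ := exists_color_avoiding f (Finset.univ.filter (G.Adj u))
      (Nat.lt_succ_of_le (h u _ (by simp)))
    refine ⟨Function.update f u c, ?_⟩
    rw [Finset.coe_insert]
    exact hf.insert_vertex u c fun w _ huw => hc w (by simpa using huw)

/-- Greedy coloring of `U` toward the vertex `t`. -/
lemma ProperOn.extend_toward {V : Type*} [Fintype V] {G : SimpleGraph V} (hdeg : G.DegLE 3)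
    (ρ : V → ℕ) (t : V) (U : Finset V) :
    ∀ f : V → Fin 3, G.ProperOn (U : Set V)ᶜ f →
    (∀ u ∈ U, u ≠ t → ∃ w ∈ U, G.Adj u w ∧ ρ w < ρ u) →
    ∃ g : V → Fin 3, (∀ x ∉ U, g x = f x) ∧ G.ProperOn {t}ᶜ g := by
  classical
  induction U using Finset.strongInduction with
  | H U ih =>
    intro f hf hU
    by_cases hne : (U.erase t).Nonempty
    -- The vertex of largest rank goes first: its neighbour of smaller rank is still uncolored, so
    -- at most two neighbours are colored and one of three colors is free.
    · obtain ⟨u, hu, hmax⟩ := Finset.exists_max_image (U.erase t) ρ hne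
      obtain ⟨hut, huU⟩ := Finset.mem_erase.1 hu
      obtain ⟨w, hwU, huw, -⟩ := hU u huU hut
      obtain ⟨c, hc⟩ := exists_color_avoiding f
        (Finset.univ.filter fun x => G.Adj u x ∧ x ∉ U) (by
          have := hdeg u (insert w (Finset.univ.filter fun x => G.Adj u x ∧ x ∉ U)) (by
            intro x hx
            rcases Finset.mem_insert.1 hx with rfl | hx
            · exact huw
            · exact (Finset.mem_filter.1 hx).2.1)
          rw [Finset.card_insert_of_notMem (by simp [hwU])] at this
          omega)
      obtain ⟨g, hg, hgp⟩ := ih (U.erase u) (Finset.erase_ssubset huU) (Function.update f u c) (by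
          refine (hf.insert_vertex u c ?_).mono ?_
          · intro x hx hux
            exact hc x (by simpa [hux] using hx)
          · intro x hx
            by_cases h : x = u
            · exact Or.inl h
            · right; simpa [h] using hx) (by
          intro x hx hxt
          obtain ⟨hxu, hxU⟩ := Finset.mem_erase.1 hx
          obtain ⟨y, hyU, hxy, hlt⟩ := hU x hxU hxt
          refine ⟨y, Finset.mem_erase.2 ⟨?_, hyU⟩, hxy, hlt⟩
          rintro rfl
          have := hmax x (Finset.mem_erase.2 ⟨hxt, hxU⟩)
          omega)
      refine ⟨g, fun x hx => ?_, hgp⟩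
      have hxu : x ≠ u := fun h => hx (h ▸ huU)
      rw [hg x (by simp [hx]), Function.update_of_ne hxu]
    · refine ⟨f, fun _ _ => rfl, hf.mono ?_⟩
      intro x hx hxU
      exact hne ⟨x, Finset.mem_erase.2 ⟨hx, hxU⟩⟩

/-- A vertex with two neighbours of the same color can be colored. -/
lemma ProperOn.finish {V : Type*} [Fintype V] {G : SimpleGraph V} (hdeg : G.DegLE 3)
    {t x y : V} {f : V → Fin 3} (hf : G.ProperOn {t}ᶜ f) (hx : G.Adj t x) (hy : G.Adj t y)
    (hxy : x ≠ y) (hfxy : f x = f y) : ∃ g : V → Fin 3, G.ProperOn Set.univ g := by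
  classical
  obtain ⟨c, hc⟩ := exists_color_avoiding f ((Finset.univ.filter (G.Adj t)).erase x) (by
    rw [Finset.card_erase_of_mem (by simpa using hx)]
    have := hdeg t (Finset.univ.filter (G.Adj t)) (by simp)
    omega)
  refine ⟨_, (hf.insert_vertex t c ?_).mono fun z _ => ?_⟩
  · intro w _ htw
    by_cases hwx : w = x
    · rw [hwx, hfxy]
      exact hc y (by simp [hxy.symm, hy])
    · exact hc w (by simp [hwx, htw])
  · by_cases h : z = t
    · exact Or.inl h
    · exact Or.inr h

/-- The first `r` values of `p` form a path of `G`. -/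
def IsPathSeq {V : Type*} (G : SimpleGraph V) (p : ℕ → V) (r : ℕ) : Prop :=
  Set.InjOn p (Set.Iio r) ∧ ∀ i, i + 1 < r → G.Adj (p i) (p (i + 1))

lemma IsPathSeq.card_le {V : Type*} [Fintype V] {G : SimpleGraph V} {p : ℕ → V} {r : ℕ}
    (h : G.IsPathSeq p r) : r ≤ Fintype.card V := by
  classical
  have := Finset.card_le_univ ((Finset.range r).image p)
  rwa [Finset.card_image_of_injOn (by simpa using h.1), Finset.card_range] at this

lemma IsPathSeq.snoc {V : Type*} {G : SimpleGraph V} {p : ℕ → V} {r : ℕ}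
    (h : G.IsPathSeq p r) (w : V) (hw : ∀ i < r, p i ≠ w)
    (hadj : ∀ i, i + 1 = r → G.Adj (p i) w) :
    G.IsPathSeq (fun i => if i < r then p i else w) (r + 1) := by
  constructor
  · intro i hi j hj hij
    simp only [Set.mem_Iio] at hi hj
    by_cases hi' : i < r <;> by_cases hj' : j < r
    · simp only [hi', hj', if_true] at hij
      exact h.1 hi' hj' hij
    · simp only [hi', hj', if_true, if_false] at hij
      exact (hw i hi' hij).elim
    · simp only [hi', hj', if_true, if_false] at hij
      exact (hw j hj' hij.symm).elim
    · omega
  · intro i hi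
    by_cases hi' : i + 1 < r
    · have : i < r := by omega
      simpa [hi', this] using h.2 i hi'
    · have : i < r := by omega
      simpa [hi', this] using hadj i (by omega)

/-- Path lengths are bounded by the number of vertices, so a greatest one exists. Being longest is
used only as "no path has one more vertex". -/
lemma exists_longest_pathSeq {V : Type*} [Fintype V] [Nonempty V] (G : SimpleGraph V) :
    ∃ p r, 1 ≤ r ∧ G.IsPathSeq p r ∧ ∀ q, ¬ G.IsPathSeq q (r + 1) := by
  classical
  let P : ℕ → Prop := fun r => ∃ p, G.IsPathSeq p r
  have h1 : P 1 := ⟨fun _ => Classical.arbitrary V, by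
    intro i hi j hj _
    simp only [Set.mem_Iio] at hi hj
    omega, by omega⟩
  have hc : 1 ≤ Fintype.card V := Fintype.card_pos
  obtain ⟨p, hp⟩ := Nat.findGreatest_spec hc h1
  refine ⟨p, _, Nat.le_findGreatest hc h1, hp, fun q hq => ?_⟩
  have : Nat.findGreatest P (Fintype.card V) + 1 ≤ Nat.findGreatest P (Fintype.card V) :=
    Nat.le_findGreatest hq.card_le ⟨q, hq⟩
  omega

/-- A Hamiltonian cycle with two nonadjacent vertices at distance two along it. -/
lemma exists_properOn_of_hamiltonian {V : Type*} [Fintype V] {G : SimpleGraph V}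
    (hdeg : G.DegLE 3) (hmin : ∀ v, ∃ T : Finset V, (∀ w ∈ T, G.Adj v w) ∧ T.card = 3)
    {q : ℕ → V} {r : ℕ} (hr : 4 ≤ r) (hq : ∀ i, G.Adj (q i) (q (i + 1)))
    (hinj : Set.InjOn q (Set.Iio r)) (hsurj : ∀ v, ∃ i < r, q i = v)
    (h02 : ¬ G.Adj (q 0) (q 2)) : ∃ g : V → Fin 3, G.ProperOn Set.univ g := by
  classical
  obtain ⟨ρ, hρ⟩ : ∃ ρ : V → ℕ, ∀ i < r, ρ (q i) = i :=
    ⟨Function.invFunOn q (Set.Iio r), fun i hi => hinj.leftInvOn_invFunOn hi⟩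
  have hne : ∀ i < r, ∀ j < r, i ≠ j → q i ≠ q j := fun i hi j hj hij h => hij (hinj hi hj h)
  obtain ⟨T, hT, hTc⟩ := hmin (q 1)
  obtain ⟨w, hwT, hw⟩ : ∃ w ∈ T, w ∉ ({q 0, q 2} : Finset V) := by
    apply Finset.exists_mem_notMem_of_card_lt_card
    rw [hTc]
    exact (Finset.card_le_two).trans_lt (by norm_num)
  obtain ⟨m, hm, rfl⟩ := hsurj w
  have hadj := hT _ hwT
  have hm0 : m ≠ 0 := by rintro rfl; simp at hw
  have hm2 : m ≠ 2 := by rintro rfl; simp at hw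
  have hm1 : m ≠ 1 := by rintro rfl; exact G.irrefl hadj
  -- Give `q 0` and `q 2` the same color and save their common neighbour `q 1` for the end. Its
  -- third neighbour `q m` lies on the arc left after deleting `q 0`, `q 1`, `q 2`; the rank counts
  -- steps along this arc to `q m` and one more step to `q 1`.
  obtain ⟨g, hg, hgp⟩ := ProperOn.extend_toward hdeg
    (fun v => if ρ v = 1 then 0 else 1 + (ρ v - m) + (m - ρ v)) (q 1)
    (Finset.univ \ {q 0, q 2}) (fun _ => 0) (by
      intro u hu v hv huv
      exfalso
      simp only [Finset.coe_sdiff, Finset.coe_univ, Set.mem_compl_iff, Set.mem_sdiff, Set.mem_univ,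
        true_and, not_not, Finset.coe_insert, Finset.coe_singleton, Set.mem_insert_iff,
        Set.mem_singleton_iff] at hu hv
      rcases hu with rfl | rfl <;> rcases hv with rfl | rfl
      · exact G.irrefl huv
      · exact h02 huv
      · exact h02 huv.symm
      · exact G.irrefl huv) (by
      intro u hu hu1
      obtain ⟨i, hi, rfl⟩ := hsurj u
      simp only [Finset.mem_sdiff, Finset.mem_univ, true_and, Finset.mem_insert,
        Finset.mem_singleton, not_or] at hu
      have hi0 : i ≠ 0 := by rintro rfl; exact hu.1 rfl
      have hi2 : i ≠ 2 := by rintro rfl; exact hu.2 rfl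
      have hi1 : i ≠ 1 := by rintro rfl; exact hu1 rfl
      have key : ∀ j < r, j ≠ 0 → j ≠ 2 → q j ∈ (Finset.univ \ {q 0, q 2} : Finset V) := by
        intro j hj h0 h2
        simp [hne j hj 0 (by omega) h0, hne j hj 2 (by omega) h2]
      rcases lt_trichotomy i m with h | h | h
      · refine ⟨q (i + 1), key _ (by omega) (by omega) (by omega), hq i, ?_⟩
        simp only [hρ i hi, hρ (i + 1) (by omega)]
        split_ifs <;> omega
      · subst h
        refine ⟨q 1, key 1 (by omega) (by omega) (by omega), hadj.symm, ?_⟩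
        simp only [hρ i hi, hρ 1 (by omega)]
        simp [hi1]
      · obtain ⟨i, rfl⟩ : ∃ k, i = k + 1 := ⟨i - 1, by omega⟩
        refine ⟨q i, key _ (by omega) (by omega) (by omega), (hq i).symm, ?_⟩
        simp only [hρ i (by omega), hρ (i + 1) (by omega)]
        split_ifs <;> omega)
  exact hgp.finish hdeg (hq 0).symm (hq 1) (hne 0 (by omega) 2 (by omega) (by omega))
    (by rw [hg _ (by simp), hg _ (by simp)])

/-- A path whose last vertex has all its neighbours on the path, but not its first vertex. -/
lemma exists_properOn_of_path {V : Type*} [Fintype V] {G : SimpleGraph V}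
    (hdeg : G.DegLE 3) (hcrit : ∀ S : Set V, S ≠ Set.univ → ∃ f : V → Fin 3, G.ProperOn S f)
    {p : ℕ → V} {r j : ℕ} (hp : G.IsPathSeq p (r + 1)) (hj : j + 1 < r)
    (hnb : ∀ w, G.Adj (p r) w → ∃ i, j + 1 ≤ i ∧ i < r ∧ p i = w)
    (hadj : G.Adj (p r) (p (j + 1)) ) :
    ∃ g : V → Fin 3, G.ProperOn Set.univ g := by
  classical
  obtain ⟨ρ, hρ⟩ : ∃ ρ : V → ℕ, ∀ i < r + 1, ρ (p i) = i :=
    ⟨Function.invFunOn p (Set.Iio (r + 1)), fun i hi => hp.1.leftInvOn_invFunOn hi⟩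
  have hne : ∀ i < r + 1, ∀ j < r + 1, i ≠ j → p i ≠ p j :=
    fun i hi j hj hij h => hij (hp.1 hi hj h)
  set D : Finset V := (Finset.Ico (j + 1) r).image p with hD
  have memD : ∀ i < r + 1, p i ∈ D ↔ j + 1 ≤ i ∧ i < r := by
    intro i hi
    simp only [hD, Finset.mem_image, Finset.mem_Ico]
    constructor
    · rintro ⟨k, hk, hki⟩
      have : k = i := by
        by_contra h
        exact hne k (by omega) i hi h hki
      omega
    · exact fun h => ⟨i, h, rfl⟩
  obtain ⟨f, hf⟩ := hcrit (insert (p r) (D : Set V))ᶜ (by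
    intro h
    have : p r ∈ (insert (p r) (D : Set V))ᶜ := h ▸ Set.mem_univ _
    simp at this)
  -- All neighbours of `p r` are in the uncolored segment `D`, so `p r` may copy the color of `p j`.
  -- Coloring `D` down to `p (j + 1)` leaves a vertex with two neighbours of equal color, `p j` and
  -- `p r`.
  obtain ⟨g, hg, hgp⟩ := ProperOn.extend_toward hdeg ρ (p (j + 1)) D
    (Function.update f (p r) (f (p j))) (by
      refine (hf.insert_vertex (p r) (f (p j)) ?_).mono ?_
      · intro w hw hrw
        obtain ⟨i, hi, hir, rfl⟩ := hnb w hrw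
        exact (hw (Or.inr ((memD i (by omega)).2 ⟨hi, hir⟩))).elim
      · intro x hx
        by_cases h : x = p r
        · exact Or.inl h
        · right
          simpa [h] using hx) (by
      intro u hu hu1
      obtain ⟨i, hi, rfl⟩ := Finset.mem_image.1 hu
      rw [Finset.mem_Ico] at hi
      have : i ≠ j + 1 := by rintro rfl; exact hu1 rfl
      obtain ⟨i, rfl⟩ : ∃ k, i = k + 1 := ⟨i - 1, by omega⟩
      refine ⟨p i, (memD i (by omega)).2 (by omega), (hp.2 i (by omega)).symm, ?_⟩
      rw [hρ i (by omega), hρ (i + 1) (by omega)]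
      omega)
  refine hgp.finish hdeg hadj.symm (hp.2 j (by omega)).symm
    (hne r (by omega) j (by omega) (by omega)) ?_
  rw [hg (p r) (by rw [memD r (by omega)]; omega), hg (p j) (by rw [memD j (by omega)]; omega),
    Function.update_self, Function.update_of_ne (hne j (by omega) r (by omega) (by omega))]

/-- Take a longest path; the neighbours of its last vertex are all on it. If the first vertex is not
among them, `exists_properOn_of_path` applies. Otherwise the path closes to a cycle, which is
Hamiltonian by maximality and criticality. A missing chord between vertices at distance two gives a
coloring; if all such chords are present, degree three forces K₄. -/
lemma exists_properOn_of_critical {V : Type*} [Fintype V] {G : SimpleGraph V}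
    (hdeg : G.DegLE 3) (hK : G.CliqueFree 4)
    (hcrit : ∀ S : Set V, S ≠ Set.univ → ∃ f : V → Fin 3, G.ProperOn S f) :
    ∃ g : V → Fin 3, G.ProperOn Set.univ g := by
  classical
  by_contra hno
  have hV : Nonempty V := by
    by_contra h
    rw [not_nonempty_iff] at h
    exact hno ⟨fun _ => 0, fun u => h.elim u⟩
  have hmin : ∀ v, ∃ T : Finset V, (∀ w ∈ T, G.Adj v w) ∧ T.card = 3 := by
    intro v
    refine ⟨Finset.univ.filter (G.Adj v), by simp, le_antisymm (hdeg v _ (by simp)) ?_⟩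
    by_contra hlt
    obtain ⟨f, hf⟩ := hcrit {v}ᶜ (by
      intro h
      have : v ∈ ({v}ᶜ : Set V) := h ▸ Set.mem_univ _
      simp at this)
    obtain ⟨c, hc⟩ := exists_color_avoiding f (Finset.univ.filter (G.Adj v)) (by omega)
    refine hno ⟨_, (hf.insert_vertex v c fun w _ h => hc w (by simpa using h)).mono
      fun z _ => ?_⟩
    by_cases h : z = v
    · exact Or.inl h
    · exact Or.inr h
  obtain ⟨p, r, hr, hp, hmax⟩ := G.exists_longest_pathSeq
  obtain ⟨r, rfl⟩ : ∃ k, r = k + 1 := ⟨r - 1, by omega⟩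
  have hne : ∀ i < r + 1, ∀ j < r + 1, i ≠ j → p i ≠ p j :=
    fun i hi j hj hij h => hij (hp.1 hi hj h)
  have hlast : ∀ w, G.Adj (p r) w → ∃ i < r, p i = w := by
    intro w hw
    by_contra! h
    refine hmax _ (hp.snoc w ?_ ?_)
    · intro i hi
      rcases Nat.lt_succ_iff_lt_or_eq.1 hi with hi | rfl
      · exact h i hi
      · exact hw.ne
    · intro i hi
      obtain rfl : i = r := by omega
      exact hw
  have hex : ∃ j, j < r ∧ G.Adj (p r) (p j) := by
    obtain ⟨T, hT, hTc⟩ := hmin (p r)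
    obtain ⟨w, hw⟩ := Finset.card_pos.1 (by omega : 0 < T.card)
    obtain ⟨i, hi, rfl⟩ := hlast w (hT w hw)
    exact ⟨i, hi, hT _ hw⟩
  have hj := Nat.find_spec hex
  have hjmin : ∀ i, i < r → G.Adj (p r) (p i) → Nat.find hex ≤ i :=
    fun i hi h => Nat.find_min' hex ⟨hi, h⟩
  set j := Nat.find hex
  rcases Nat.eq_zero_or_pos j with hj0 | hjpos
  swap
  · obtain ⟨j', hj'⟩ : ∃ k, j = k + 1 := ⟨j - 1, by omega⟩
    rw [hj'] at hj hjmin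
    refine hno (exists_properOn_of_path hdeg hcrit hp hj.1 ?_ hj.2)
    intro w hw
    obtain ⟨i, hi, rfl⟩ := hlast w hw
    exact ⟨i, hjmin i hi hw, hi, rfl⟩
  rw [hj0] at hj
  have hmod : ∀ i, i % (r + 1) < r + 1 := fun i => Nat.mod_lt _ (by omega)
  have hcyc : ∀ i, G.Adj (p (i % (r + 1))) (p ((i + 1) % (r + 1))) := by
    intro i
    have := hmod i
    by_cases h : i % (r + 1) + 1 < r + 1
    · have h2 : (i + 1) % (r + 1) = i % (r + 1) + 1 := by
        rw [Nat.add_mod, Nat.mod_eq_of_lt (by omega : 1 < r + 1), Nat.mod_eq_of_lt h]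
      rw [h2]
      exact hp.2 _ h
    · have h1 : i % (r + 1) = r := by omega
      have h2 : (i + 1) % (r + 1) = 0 := by
        rw [Nat.add_mod, h1, Nat.mod_eq_of_lt (by omega : 1 < r + 1), Nat.mod_self]
      rw [h1, h2]
      exact hj.2
  have hinj : ∀ s, Set.InjOn (fun i => p ((s + i) % (r + 1))) (Set.Iio (r + 1)) := by
    intro s i hi k hk hik
    have h1 := hp.1 (hmod _) (hmod _) hik
    have h2 : i ≡ k [MOD r + 1] := Nat.ModEq.add_left_cancel' s h1
    exact Nat.ModEq.eq_of_lt_of_lt h2 hi hk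
  -- Opening the cycle right after `p s` gives a path that ends at `p s`; a neighbour off the cycle
  -- would prolong it.
  have hclosed : ∀ s < r + 1, ∀ w, G.Adj (p s) w → ∃ i < r + 1, p i = w := by
    intro s hs w hw
    by_contra! h
    have hpath : G.IsPathSeq (fun i => p ((s + 1 + i) % (r + 1))) (r + 1) :=
      ⟨hinj (s + 1), fun i _ => hcyc (s + 1 + i)⟩
    refine hmax _ (hpath.snoc w (fun i _ => h _ (hmod _)) ?_)
    intro i hi
    obtain rfl : i = r := by omega
    have : (s + 1 + i) % (i + 1) = s := by
      rw [show s + 1 + i = s + (i + 1) by ring, Nat.add_mod_right, Nat.mod_eq_of_lt hs]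
    simpa [this] using hw
  have hsurj : ∀ v, ∃ i < r + 1, p i = v := by
    by_contra! hv
    obtain ⟨v, hv⟩ := hv
    set S : Set V := {x | ∃ i < r + 1, p i = x} with hS
    obtain ⟨f, hf⟩ := hcrit S (by
      intro h
      obtain ⟨i, hi, hpi⟩ : v ∈ S := h ▸ Set.mem_univ _
      exact hv i hi hpi)
    obtain ⟨g, hg⟩ := hcrit Sᶜ (by
      intro h
      have : p 0 ∈ Sᶜ := h ▸ Set.mem_univ _
      exact this ⟨0, by omega, rfl⟩)
    have hSadj : ∀ x y, G.Adj x y → x ∈ S → y ∈ S := by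
      rintro x y hxy ⟨i, hi, rfl⟩
      exact hclosed i hi y hxy
    -- No edge leaves the cycle's vertex set, so colorings of it and of its complement combine.
    refine hno ⟨fun x => if x ∈ S then f x else g x, ?_⟩
    intro x _ y _ hxy
    by_cases hx : x ∈ S
    · have hy := hSadj x y hxy hx
      simpa [hx, hy] using hf x hx y hy hxy
    · have hy : y ∉ S := fun hy => hx (hSadj y x hxy.symm hy)
      simpa [hx, hy] using hg x hx y hy hxy
  have hr4 : 4 ≤ r + 1 := by
    obtain ⟨T, hT, hTc⟩ := hmin (p 0)
    have h1 : (insert (p 0) T).card = 4 := by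
      rw [Finset.card_insert_of_notMem fun h => G.irrefl (hT _ h), hTc]
    have h2 : insert (p 0) T ⊆ (Finset.range (r + 1)).image p := by
      intro x _
      obtain ⟨i, hi, rfl⟩ := hsurj x
      exact Finset.mem_image_of_mem _ (Finset.mem_range.2 hi)
    have h3 := (Finset.card_le_card h2).trans Finset.card_image_le
    rw [h1, Finset.card_range] at h3
    exact h3
  have hchord : ∀ i, G.Adj (p (i % (r + 1))) (p ((i + 2) % (r + 1))) := by
    intro i
    by_contra h
    refine hno (exists_properOn_of_hamiltonian hdeg hmin (q := fun k => p ((i + k) % (r + 1)))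
      hr4 (fun k => hcyc (i + k)) (hinj i) ?_ h)
    have hb : Set.BijOn (fun k => p ((i + k) % (r + 1))) (Finset.range (r + 1))
        ((Finset.range (r + 1)).image p) := by
      have hmaps : Set.MapsTo (fun k => p ((i + k) % (r + 1))) (Finset.range (r + 1))
          ((Finset.range (r + 1)).image p) := by
        intro k _
        exact Finset.mem_coe.2 (Finset.mem_image_of_mem _ (Finset.mem_range.2 (hmod _)))
      refine ⟨hmaps, by simpa using hinj i, ?_⟩
      exact Finset.surjOn_of_injOn_of_card_le _ hmaps (by simpa using hinj i)
        Finset.card_image_le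
    intro v
    obtain ⟨k, hk, rfl⟩ := hsurj v
    obtain ⟨m, hm, hmk⟩ := hb.surjOn
      (Finset.mem_coe.2 (Finset.mem_image_of_mem p (Finset.mem_range.2 hk)))
    exact ⟨m, by simpa using hm, hmk⟩
  have e : ∀ i, i < r + 1 → i % (r + 1) = i := fun i hi => Nat.mod_eq_of_lt hi
  have c01 := hcyc 0
  have c12 := hcyc 1
  have c23 := hcyc 2
  have d02 := hchord 0
  have d13 := hchord 1
  simp only [zero_add, Nat.reduceAdd, e 0 (by omega), e 1 (by omega), e 2 (by omega),
    e 3 (by omega)] at c01 c12 c23 d02 d13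
  -- With five or more vertices, `p 2` is adjacent to `p 0`, `p 1`, `p 3`, `p 4`, too many. With
  -- four vertices the graph is K₄.
  rcases Nat.lt_or_ge 4 (r + 1) with h5 | h5
  · have d24 := hchord 2
    simp only [Nat.reduceAdd, e 2 (by omega), e 4 (by omega)] at d24
    have hcard := hdeg (p 2) (({0, 1, 3, 4} : Finset ℕ).image p) (by
      simp [d02.symm, c12.symm, c23, d24])
    rw [Finset.card_image_of_injOn] at hcard
    · simp at hcard
    · refine hp.1.mono ?_
      intro x hx
      simp at hx
      simp only [Set.mem_Iio]
      omega
  · obtain rfl : r = 3 := by omega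
    have c30 := hcyc 3
    simp only [Nat.reduceAdd, Nat.reduceMod] at c30
    exact hK {p 0, p 1, p 2, p 3} (by
      rw [isNClique_iff, isClique_iff]
      constructor
      · intro x hx y hy hxy
        simp only [Finset.coe_insert, Finset.coe_singleton, Set.mem_insert_iff,
          Set.mem_singleton_iff] at hx hy
        rcases hx with rfl | rfl | rfl | rfl <;> rcases hy with rfl | rfl | rfl | rfl <;>
          first | exact (hxy rfl).elim | assumption | (apply G.adj_symm; assumption)
      · simp [c01.ne, c12.ne, c23.ne, d02.ne, d13.ne, c30.ne'])

/-- Brooks' theorem for graphs of maximum degree three. -/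
theorem exists_properOn_of_cliqueFree {V : Type*} [Fintype V] {G : SimpleGraph V}
    (hdeg : G.DegLE 3) (hK : G.CliqueFree 4) :
    ∃ f : V → Fin 3, G.ProperOn Set.univ f := by
  classical
  suffices H : ∀ S : Finset V, ∃ f : V → Fin 3, G.ProperOn (S : Set V) f by
    obtain ⟨f, hf⟩ := H Finset.univ
    exact ⟨f, hf.mono (by simp)⟩
  intro S
  induction S using Finset.strongInduction with
  | H S ih =>
    -- The induction hypothesis colors every proper subset of `S`, which is criticality of the
    -- induced graph.
    obtain ⟨g, hg⟩ := exists_properOn_of_critical (G := G.induce (S : Set V)) (by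
        intro v T hT
        rw [← Finset.card_map (Function.Embedding.subtype _)]
        refine hdeg v _ fun w hw => ?_
        obtain ⟨x, hx, rfl⟩ := Finset.mem_map.1 hw
        exact hT x hx) (hK.comap ⟨(Embedding.induce _).toCopy⟩) (by
        intro T hT
        obtain ⟨x, hx⟩ := (Set.ne_univ_iff_exists_notMem T).1 hT
        obtain ⟨f, hf⟩ := ih (S.erase x) (Finset.erase_ssubset x.2)
        refine ⟨fun y => f y, fun u hu v hv huv => hf u ?_ v ?_ huv⟩
        · have : u ≠ x := fun h => hx (h ▸ hu)
          simpa using fun h => this (Subtype.ext h)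
        · have : v ≠ x := fun h => hx (h ▸ hv)
          simpa using fun h => this (Subtype.ext h))
    refine ⟨fun x => if h : x ∈ S then g ⟨x, h⟩ else 0, fun u hu v hv huv => ?_⟩
    have hu' : u ∈ S := hu
    have hv' : v ∈ S := hv
    simpa [hu', hv'] using hg ⟨u, hu⟩ trivial ⟨v, hv⟩ trivial huv

/-! ### Ends of paths in graphs of maximum degree two -/

/-- A connected graph of maximum degree two has at most two vertices of degree at most one. -/
lemma Connected.false_of_three_ends {V : Type*} [Fintype V] {G : SimpleGraph V}
    (hG : G.Connected) (h2 : G.DegLE 2) {u v w : V} (huv : u ≠ v) (huw : u ≠ w) (hvw : v ≠ w)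
    (h1 : ∀ x ∈ ({u, v, w} : Set V), ∀ T : Finset V, (∀ y ∈ T, G.Adj x y) → T.card ≤ 1) :
    False := by
  classical
  have hE := hG.card_vert_le_card_edgeSet_add_one
  have hsum := G.sum_degrees_eq_twice_card_edges
  -- With n vertices the degree sum is at most 2n - 3, whereas connectedness gives at least n - 1
  -- edges and so at least 2n - 2.
  have hle : ∑ x, (G.degree x + if x ∈ ({u, v, w} : Finset V) then 1 else 0) ≤ ∑ _x : V, 2 := by
    refine Finset.sum_le_sum fun x _ => ?_
    split_ifs with h
    · have := h1 x (by simpa using h) (G.neighborFinset x) (by simp)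
      rw [card_neighborFinset_eq_degree] at this
      omega
    · have := h2 x (G.neighborFinset x) (by simp)
      rw [card_neighborFinset_eq_degree] at this
      omega
  have h3 : ({u, v, w} : Finset V).card = 3 := Finset.card_eq_three.2 ⟨u, v, w, huv, huw, hvw, rfl⟩
  rw [Finset.sum_add_distrib, hsum, Finset.sum_ite_mem, Finset.univ_inter, Finset.sum_const,
    Finset.sum_const, h3, Finset.card_univ] at hle
  rw [Nat.card_eq_fintype_card, Nat.card_eq_fintype_card, ← edgeFinset_card] at hE
  simp only [smul_eq_mul] at hle
  omega

lemma false_of_three_ends {V : Type*} [Fintype V] {G : SimpleGraph V}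
    (h2 : G.DegLE 2) {u v w : V} (huv : u ≠ v) (huw : u ≠ w) (hvw : v ≠ w)
    (h1 : ∀ x ∈ ({u, v, w} : Set V), ∀ T : Finset V, (∀ y ∈ T, G.Adj x y) → T.card ≤ 1)
    (hv : G.Reachable u v) (hw : G.Reachable u w) : False := by
  classical
  set C := G.connectedComponentMk u
  have key : ∀ (x : C.supp) (T : Finset C.supp),
      (∀ y ∈ T, (G.induce C.supp).Adj x y) → ∃ T' : Finset V, (∀ y ∈ T', G.Adj x y) ∧
        T'.card = T.card := by
    intro x T hT
    refine ⟨T.map (Function.Embedding.subtype _), fun y hy => ?_, Finset.card_map _⟩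
    obtain ⟨z, hz, rfl⟩ := Finset.mem_map.1 hy
    exact hT z hz
  have huC : u ∈ C.supp := rfl
  have hvC : v ∈ C.supp := ConnectedComponent.eq.2 hv.symm
  have hwC : w ∈ C.supp := ConnectedComponent.eq.2 hw.symm
  refine Connected.false_of_three_ends (G := G.induce C.supp) C.connected_toSimpleGraph
    (u := ⟨u, huC⟩) (v := ⟨v, hvC⟩) (w := ⟨w, hwC⟩) ?_
    (fun h => huv (congrArg Subtype.val h)) (fun h => huw (congrArg Subtype.val h))
    (fun h => hvw (congrArg Subtype.val h)) ?_
  · intro x T hT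
    obtain ⟨T', hT', hc⟩ := key x T hT
    exact hc ▸ h2 x T' hT'
  · intro x hx T hT
    obtain ⟨T', hT', hc⟩ := key x T hT
    refine hc ▸ h1 x ?_ T' hT'
    rcases hx with rfl | rfl | rfl <;> simp

/-! ### Partial edge colorings with the fewest uncolored edges -/

/-- A proper coloring of some of the edges of `G`. -/
structure IsPartialEdgeColoring {V C : Type*} (G : SimpleGraph V) (c : V → V → Option C) :
    Prop where
  symm : ∀ u v, c u v = c v u
  adj : ∀ u v a, c u v = some a → G.Adj u v
  proper : ∀ u v w a, c u v = some a → c u w = some a → v = w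

/-- No edge at `u` has color `a`. -/
def Missing {V C : Type*} (c : V → V → Option C) (u : V) (a : C) : Prop :=
  ∀ w, c u w ≠ some a

/-- `a` is the only color that is missing at `u`. -/
def MissingOnly {V C : Type*} (c : V → V → Option C) (u : V) (a : C) : Prop :=
  ∀ d, Missing c u d ↔ d = a

lemma MissingOnly.missing {V C : Type*} {c : V → V → Option C} {u : V} {a : C}
    (h : MissingOnly c u a) : Missing c u a :=
  (h a).2 rfl

open Classical in
/-- The pairs of adjacent vertices whose edge is not colored. -/
noncomputable def uncoloredPairs {V C : Type*} [Fintype V] (G : SimpleGraph V)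
    (c : V → V → Option C) : Finset (V × V) :=
  Finset.univ.filter fun p => G.Adj p.1 p.2 ∧ c p.1 p.2 = none

/-- A partial edge coloring with the least number of uncolored edges. -/
structure IsOptimal {V C : Type*} [Fintype V] (G : SimpleGraph V)
    (c : V → V → Option C) : Prop extends IsPartialEdgeColoring G c where
  le : ∀ c', G.IsPartialEdgeColoring c' →
    (G.uncoloredPairs c).card ≤ (G.uncoloredPairs (C := C) c').card

open Classical in
/-- Change the color of the edge `uv`. -/
noncomputable def setEdge {V C : Type*} (c : V → V → Option C) (u v : V) (o : Option C) :
    V → V → Option C :=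
  fun x y => if (x = u ∧ y = v) ∨ (x = v ∧ y = u) then o else c x y

section

variable {V C : Type*} {G : SimpleGraph V} {c : V → V → Option C}

lemma setEdge_self (c : V → V → Option C) (u v : V) (o : Option C) : setEdge c u v o u v = o := by
  simp [setEdge]

lemma setEdge_of_ne {u v x y : V} {o : Option C}
    (h : ¬ ((x = u ∧ y = v) ∨ (x = v ∧ y = u))) : setEdge c u v o x y = c x y := by
  simp [setEdge, h]

lemma IsPartialEdgeColoring.erase (hc : G.IsPartialEdgeColoring c) (u v : V) :
    G.IsPartialEdgeColoring (setEdge c u v none) := by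
  have key : ∀ x y a, setEdge c u v none x y = some a → c x y = some a := by
    intro x y a h
    unfold setEdge at h
    split_ifs at h
    exact h
  refine ⟨fun x y => ?_, fun x y a h => hc.adj x y a (key x y a h),
    fun x y z a h h' => hc.proper x y z a (key _ _ _ h) (key _ _ _ h')⟩
  unfold setEdge
  rw [hc.symm x y]
  congr 1
  exact propext (by tauto)

lemma IsPartialEdgeColoring.color (hc : G.IsPartialEdgeColoring c) {u v : V} {a : C}
    (huv : G.Adj u v) (hu : Missing c u a) (hv : Missing c v a) :
    G.IsPartialEdgeColoring (setEdge c u v (some a)) := by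
  refine ⟨fun x y => ?_, fun x y b h => ?_, fun x y z b h h' => ?_⟩
  · unfold setEdge
    rw [hc.symm x y]
    congr 1
    exact propext (by tauto)
  · unfold setEdge at h
    split_ifs at h with h1
    · rcases h1 with ⟨rfl, rfl⟩ | ⟨rfl, rfl⟩
      · exact huv
      · exact huv.symm
    · exact hc.adj x y b h
  · have hne := huv.ne
    unfold setEdge at h h'
    split_ifs at h with h1 <;> split_ifs at h' with h2
    · rcases h1 with ⟨rfl, rfl⟩ | ⟨rfl, rfl⟩ <;> rcases h2 with ⟨h3, rfl⟩ | ⟨h3, rfl⟩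
      · rfl
      · exact (hne h3).elim
      · exact (hne h3.symm).elim
      · rfl
    · cases h
      rcases h1 with ⟨rfl, rfl⟩ | ⟨rfl, rfl⟩
      · exact (hu z h').elim
      · exact (hv z h').elim
    · cases h'
      rcases h2 with ⟨rfl, rfl⟩ | ⟨rfl, rfl⟩
      · exact (hu y h).elim
      · exact (hv y h).elim
    · exact hc.proper x y z b h h'

/-- The count runs over ordered pairs, so one edge contributes two. -/
lemma card_uncoloredPairs_erase [Fintype V] (c : V → V → Option C) (u v : V) :
    (G.uncoloredPairs (setEdge c u v none)).card ≤ (G.uncoloredPairs c).card + 2 := by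
  classical
  have : G.uncoloredPairs (setEdge c u v none) ⊆ G.uncoloredPairs c ∪ {(u, v), (v, u)} := by
    rintro ⟨x, y⟩ h
    simp only [uncoloredPairs, Finset.mem_filter, Finset.mem_univ, true_and, Finset.mem_union,
      Finset.mem_insert, Finset.mem_singleton, Prod.mk.injEq] at h ⊢
    by_cases h1 : (x = u ∧ y = v) ∨ (x = v ∧ y = u)
    · exact Or.inr h1
    · rw [setEdge_of_ne h1] at h
      exact Or.inl h
  refine (Finset.card_le_card this).trans ((Finset.card_union_le _ _).trans ?_)
  exact Nat.add_le_add_left Finset.card_le_two _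

lemma card_uncoloredPairs_color [Fintype V] {u v : V} {a : C} (huv : G.Adj u v)
    (hc : c u v = none) (hc' : c v u = none) :
    (G.uncoloredPairs (setEdge c u v (some a))).card + 2 ≤ (G.uncoloredPairs c).card := by
  classical
  have h2 : ({(u, v), (v, u)} : Finset (V × V)).card = 2 := Finset.card_pair (by simp [huv.ne])
  rw [← h2, ← Finset.card_union_of_disjoint]
  · refine Finset.card_le_card ?_
    rintro ⟨x, y⟩ h
    simp only [uncoloredPairs, Finset.mem_filter, Finset.mem_univ, true_and, Finset.mem_union,
      Finset.mem_insert, Finset.mem_singleton, Prod.mk.injEq] at h ⊢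
    rcases h with ⟨h, h'⟩ | ⟨rfl, rfl⟩ | ⟨rfl, rfl⟩
    · unfold setEdge at h'
      split_ifs at h' with h1
      exact ⟨h, h'⟩
    · exact ⟨huv, hc⟩
    · exact ⟨huv.symm, hc'⟩
  · rw [Finset.disjoint_left]
    rintro ⟨x, y⟩ h h'
    simp only [uncoloredPairs, Finset.mem_filter, Finset.mem_univ, true_and,
      Finset.mem_insert, Finset.mem_singleton, Prod.mk.injEq] at h h'
    have := h.2
    unfold setEdge at this
    rw [if_pos h'] at this
    cases this

lemma IsOptimal.not_missing [Fintype V] (hc : G.IsOptimal c) {u v : V} {a : C}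
    (huv : G.Adj u v) (h : c u v = none) (hu : Missing c u a) : ¬ Missing c v a := by
  intro hv
  have h1 := hc.le _ (hc.color huv hu hv)
  have h2 := card_uncoloredPairs_color (a := a) huv h (hc.symm u v ▸ h)
  omega

/-- The uncolored edge `uv` is exchanged with the edge `ux`. -/
lemma IsOptimal.shift [Fintype V] (hc : G.IsOptimal c) {u v x : V} {a : C}
    (huv : G.Adj u v) (h : c u v = none) (hx : c u x = some a) (hv : Missing c v a) :
    G.IsOptimal (setEdge (setEdge c u x none) u v (some a)) := by
  have hxv : v ≠ x := by rintro rfl; simp [h] at hx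
  have hux : u ≠ x := (hc.adj _ _ _ hx).ne
  have h1 : ¬ ((u = u ∧ v = x) ∨ (u = x ∧ v = u)) := by tauto
  have hmu : Missing (setEdge c u x none) u a := by
    intro w hw
    unfold setEdge at hw
    split_ifs at hw with h2
    exact h2 (Or.inl ⟨rfl, hc.proper _ _ _ _ hw hx⟩)
  have hmv : Missing (setEdge c u x none) v a := by
    intro w hw
    unfold setEdge at hw
    split_ifs at hw with h2
    exact hv w hw
  have hE := hc.erase u x
  refine ⟨hE.color huv hmu hmv, fun c' hc' => ?_⟩
  have h3 : setEdge c u x none u v = none := by rw [setEdge_of_ne h1, h]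
  have h4 := card_uncoloredPairs_erase (G := G) c u x
  have h5 := card_uncoloredPairs_color (G := G) (a := a) huv h3 (hE.symm u v ▸ h3)
  have h6 := hc.le c' hc'
  omega

end

/-! ### Kempe chains -/

/-- The subgraph formed by the edges of color `a` or `b`. -/
def kempe {V C : Type*} (c : V → V → Option C) (a b : C) : SimpleGraph V :=
  fromRel fun u v => c u v = some a ∨ c u v = some b

open Classical in
/-- Exchange the colors `a` and `b` inside `X`. -/
noncomputable def kempeSwap {V C : Type*} (c : V → V → Option C) (a b : C) (X : Set V) :
    V → V → Option C :=
  fun x y => if x ∈ X ∧ y ∈ X then (c x y).map (Equiv.swap a b) else c x y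

section

variable {V C : Type*} {G : SimpleGraph V} {c : V → V → Option C}

lemma IsPartialEdgeColoring.kempe_adj (hc : G.IsPartialEdgeColoring c) {a b : C} {u v : V} :
    (kempe c a b).Adj u v ↔ c u v = some a ∨ c u v = some b := by
  rw [kempe, fromRel_adj, hc.symm v u, or_self]
  refine ⟨fun h => h.2, fun h => ⟨?_, h⟩⟩
  rcases h with h | h <;> exact (hc.adj _ _ _ h).ne

lemma IsPartialEdgeColoring.kempe_degLE (hc : G.IsPartialEdgeColoring c) (a b : C) :
    (kempe c a b).DegLE 2 := by
  classical
  intro v T hT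
  refine le_trans ?_ (Finset.card_le_two (a := some a) (b := some b))
  refine Finset.card_le_card_of_injOn (c v) ?_ ?_
  · intro w hw
    simpa using hc.kempe_adj.1 (hT w hw)
  · intro w hw w' hw' h
    rcases hc.kempe_adj.1 (hT w hw) with h1 | h1
    · exact hc.proper v w w' a h1 (h ▸ h1)
    · exact hc.proper v w w' b h1 (h ▸ h1)

lemma IsPartialEdgeColoring.kempe_end (hc : G.IsPartialEdgeColoring c) {a b : C} {v : V}
    (hv : Missing c v a ∨ Missing c v b) (T : Finset V)
    (hT : ∀ w ∈ T, (kempe c a b).Adj v w) : T.card ≤ 1 := by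
  rw [Finset.card_le_one]
  intro w hw w' hw'
  have h := hc.kempe_adj.1 (hT w hw)
  have h' := hc.kempe_adj.1 (hT w' hw')
  rcases hv with hv | hv
  · exact hc.proper v w w' b (h.resolve_left (hv w)) (h'.resolve_left (hv w'))
  · exact hc.proper v w w' a (h.resolve_right (hv w)) (h'.resolve_right (hv w'))

/-- A vertex missing `a` or `b` is an end of its Kempe chain, and a chain, being a path or a cycle,
has at most two ends. -/
lemma IsPartialEdgeColoring.false_of_three_ends [Fintype V] (hc : G.IsPartialEdgeColoring c)
    {a b : C} {u v w : V} (huv : u ≠ v) (huw : u ≠ w) (hvw : v ≠ w)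
    (hu : Missing c u a ∨ Missing c u b) (hv : Missing c v a ∨ Missing c v b)
    (hw : Missing c w a ∨ Missing c w b)
    (hrv : (kempe c a b).Reachable u v) (hrw : (kempe c a b).Reachable u w) : False := by
  refine SimpleGraph.false_of_three_ends (hc.kempe_degLE a b) huv huw hvw ?_ hrv hrw
  rintro x (rfl | rfl | rfl)
  · exact hc.kempe_end hu
  · exact hc.kempe_end hv
  · exact hc.kempe_end hw

lemma kempeSwap_of_notMem {a b : C} {X : Set V} {u : V} (hu : u ∉ X) (v : V) :
    kempeSwap c a b X u v = c u v := by
  simp [kempeSwap, hu]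

/-- An edge leaving a union of chains has neither color, so the swap fixes it. Hence the swap acts
on all edges at `u`, although `kempeSwap` changes only edges with both ends in `X`. -/
lemma IsPartialEdgeColoring.kempeSwap_of_mem [DecidableEq C]
    (hc : G.IsPartialEdgeColoring c) {a b : C}
    {X : Set V} (hX : ∀ x y, (kempe c a b).Adj x y → x ∈ X → y ∈ X) {u : V} (hu : u ∈ X)
    (v : V) : kempeSwap c a b X u v = (c u v).map (Equiv.swap a b) := by
  by_cases hv : v ∈ X
  · simp only [kempeSwap, hu, hv, and_self, if_true]
    congr!
  · simp only [kempeSwap, hu, hv, and_false, if_false]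
    have h : ¬ (kempe c a b).Adj u v := fun h => hv (hX u v h hu)
    rw [hc.kempe_adj, not_or] at h
    cases hd : c u v with
    | none => rfl
    | some d =>
      rw [hd] at h
      rw [Option.map_some, Equiv.swap_apply_of_ne_of_ne]
      · rintro rfl; exact h.1 rfl
      · rintro rfl; exact h.2 rfl

lemma IsPartialEdgeColoring.kempeSwap [DecidableEq C]
    (hc : G.IsPartialEdgeColoring c) {a b : C}
    {X : Set V} (hX : ∀ x y, (kempe c a b).Adj x y → x ∈ X → y ∈ X) :
    G.IsPartialEdgeColoring (kempeSwap c a b X) := by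
  refine ⟨fun u v => ?_, fun u v d h => ?_, fun u v w d h h' => ?_⟩
  · unfold SimpleGraph.kempeSwap
    rw [hc.symm u v]
    by_cases hu : u ∈ X <;> by_cases hv : v ∈ X <;> simp [hu, hv]
  · by_cases hu : u ∈ X
    · rw [hc.kempeSwap_of_mem hX hu, Option.map_eq_some_iff] at h
      obtain ⟨e, he, -⟩ := h
      exact hc.adj _ _ _ he
    · rw [kempeSwap_of_notMem hu] at h
      exact hc.adj _ _ _ h
  · by_cases hu : u ∈ X
    · rw [hc.kempeSwap_of_mem hX hu, Option.map_eq_some_iff] at h h'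
      obtain ⟨e, he, h1⟩ := h
      obtain ⟨e', he', h2⟩ := h'
      obtain rfl := (Equiv.swap a b).injective (h1.trans h2.symm)
      exact hc.proper _ _ _ _ he he'
    · rw [kempeSwap_of_notMem hu] at h h'
      exact hc.proper _ _ _ _ h h'

lemma kempeSwap_eq_none {a b : C} {X : Set V} (u v : V) :
    SimpleGraph.kempeSwap c a b X u v = none ↔ c u v = none := by
  unfold SimpleGraph.kempeSwap
  split_ifs
  · exact Option.map_eq_none_iff
  · rfl

lemma IsPartialEdgeColoring.missing_kempeSwap [DecidableEq C]
    (hc : G.IsPartialEdgeColoring c) {a b : C}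
    {X : Set V} (hX : ∀ x y, (kempe c a b).Adj x y → x ∈ X → y ∈ X) {u : V} (hu : u ∈ X)
    (d : C) : Missing (SimpleGraph.kempeSwap c a b X) u d ↔ Missing c u (Equiv.swap a b d) := by
  unfold Missing
  refine forall_congr' fun w => not_congr ?_
  rw [hc.kempeSwap_of_mem hX hu, Option.map_eq_some_iff]
  constructor
  · rintro ⟨e, he, rfl⟩
    simpa using he
  · exact fun h => ⟨_, h, by simp⟩

lemma missing_kempeSwap_of_notMem {a b : C} {X : Set V} {u : V} (hu : u ∉ X) (d : C) :
    Missing (SimpleGraph.kempeSwap c a b X) u d ↔ Missing c u d := by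
  unfold Missing
  simp only [kempeSwap_of_notMem hu]

lemma uncoloredPairs_kempeSwap [Fintype V] {a b : C} {X : Set V} :
    G.uncoloredPairs (SimpleGraph.kempeSwap c a b X) = G.uncoloredPairs c := by
  ext p
  simp [uncoloredPairs, kempeSwap_eq_none]

lemma reachable_closed (K : SimpleGraph V) (v x y : V) (hxy : K.Adj x y)
    (hx : x ∈ {x | K.Reachable v x}) : y ∈ {x | K.Reachable v x} :=
  Reachable.trans hx hxy.reachable

/-- The Kempe chain that leaves an end of an uncolored edge arrives at the other end. -/
lemma IsOptimal.reachable [Fintype V] [DecidableEq C] (hc : G.IsOptimal c) {u v : V} {a b : C}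
    (huv : G.Adj u v) (h : c u v = none) (hu : Missing c u a) (hv : Missing c v b) :
    (kempe c a b).Reachable u v := by
  by_contra hr
  -- Swapping on the chain of `v`, which avoids `u`, would make `a` missing at both ends, and `uv`
  -- could then be colored.
  set X : Set V := {x | (kempe c a b).Reachable v x} with hX
  have hcl : ∀ x y, (kempe c a b).Adj x y → x ∈ X → y ∈ X := reachable_closed (kempe c a b) v
  have huX : u ∉ X := fun hu => hr (Reachable.symm hu)
  have hvX : v ∈ X := Reachable.refl v
  have hs := hc.kempeSwap hcl
  have h1 : Missing (SimpleGraph.kempeSwap c a b X) u a := (missing_kempeSwap_of_notMem huX a).2 hu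
  have h2 : Missing (SimpleGraph.kempeSwap c a b X) v a :=
    (hc.missing_kempeSwap hcl hvX a).2 (by simpa using hv)
  have h3 := (kempeSwap_eq_none (a := a) (b := b) (X := X) u v).2 h
  have h4 := hc.le _ (hs.color huv h1 h2)
  have h5 := card_uncoloredPairs_color (G := G) (a := a) huv h3 (hs.symm u v ▸ h3)
  rw [uncoloredPairs_kempeSwap] at h5
  omega

end

/-! ### Uncolored edges when at most three colors are available -/

section

variable {V : Type*} {G : SimpleGraph V} {D : ℕ} {c : V → V → Option (Fin D)}

-- The colors present at `u` inject into neighbours along colored edges; with the disjoint set `T`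
-- these are at most `D` neighbours.
open Classical in
lemma IsPartialEdgeColoring.card_le_card_missing (hc : G.IsPartialEdgeColoring c)
    (hdeg : G.DegLE D) (u : V) (T : Finset V) (hT : ∀ w ∈ T, G.Adj u w ∧ c u w = none) :
    T.card ≤ (Finset.univ.filter (Missing c u)).card := by
  have hex : ∀ a, ¬ Missing c u a → ∃ w, c u w = some a := by
    intro a h
    unfold Missing at h
    push Not at h
    exact h
  have : ∀ a, ∃ w, ¬ Missing c u a → c u w = some a := by
    intro a
    by_cases h : Missing c u a
    · exact ⟨u, fun h' => (h' h).elim⟩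
    · obtain ⟨w, hw⟩ := hex a h
      exact ⟨w, fun _ => hw⟩
  choose n hn using this
  set S := Finset.univ.filter fun a => ¬ Missing c u a with hS
  have hinj : Set.InjOn n S := by
    intro a ha b hb hab
    have h1 := hn a (by simpa [hS] using ha)
    have h2 := hn b (by simpa [hS] using hb)
    rw [hab, h2] at h1
    exact (Option.some.inj h1).symm
  have hdisj : Disjoint (S.image n) T := by
    rw [Finset.disjoint_left]
    intro w hw hwT
    obtain ⟨a, ha, rfl⟩ := Finset.mem_image.1 hw
    have h1 := hn a (by simpa [hS] using ha)
    rw [(hT _ hwT).2] at h1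
    cases h1
  have h1 := hdeg u (S.image n ∪ T) (by
    intro w hw
    rcases Finset.mem_union.1 hw with hw | hw
    · obtain ⟨a, ha, rfl⟩ := Finset.mem_image.1 hw
      exact hc.adj _ _ _ (hn a (by simpa [hS] using ha))
    · exact (hT w hw).1)
  rw [Finset.card_union_of_disjoint hdisj, Finset.card_image_of_injOn hinj] at h1
  have h2 : (Finset.univ.filter (Missing c u)).card + S.card = D := by
    rw [hS]
    convert Finset.card_filter_add_card_filter_not (s := (Finset.univ : Finset (Fin D)))
      (Missing c u)
    simp
  omega

lemma IsPartialEdgeColoring.exists_missing (hc : G.IsPartialEdgeColoring c)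
    (hdeg : G.DegLE D) {u v : V} (huv : G.Adj u v) (h : c u v = none) : ∃ a, Missing c u a := by
  classical
  have h1 := hc.card_le_card_missing hdeg u {v} (by simp [huv, h])
  obtain ⟨a, ha⟩ := Finset.card_pos.1 (by simpa using h1 : 0 < _)
  exact ⟨a, by simpa using ha⟩

variable [Fintype V]

/-- The uncolored edges of an optimal coloring form a matching. -/
lemma IsOptimal.matching (hc : G.IsOptimal c) (hD : D ≤ 3) (hdeg : G.DegLE D) {u v w : V}
    (huv : G.Adj u v) (hv : c u v = none) (huw : G.Adj u w) (hw : c u w = none) : v = w := by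
  classical
  by_contra hne
  have h1 := hc.card_le_card_missing hdeg u {v, w} (by simp [huv, hv, huw, hw])
  rw [Finset.card_pair hne] at h1
  obtain ⟨a, ha, b, hb, hab⟩ := Finset.one_lt_card.1
    (by omega : 1 < (Finset.univ.filter (Missing c u)).card)
  obtain ⟨d, hd⟩ := hc.exists_missing hdeg huv.symm (hc.symm u v ▸ hv)
  obtain ⟨e, he⟩ := hc.exists_missing hdeg huw.symm (hc.symm u w ▸ hw)
  replace ha : Missing c u a := by simpa using ha
  replace hb : Missing c u b := by simpa using hb
  have had : a ≠ d := by rintro rfl; exact hc.not_missing huv hv ha hd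
  have hbd : b ≠ d := by rintro rfl; exact hc.not_missing huv hv hb hd
  have hae : a ≠ e := by rintro rfl; exact hc.not_missing huw hw ha he
  have hbe : b ≠ e := by rintro rfl; exact hc.not_missing huw hw hb he
  -- Among at most three colors only one differs from `a` and `b`, so the `a`/`d` chain from `u`
  -- would have to end at both `v` and `w`.
  obtain rfl : d = e := by omega
  exact hc.false_of_three_ends (a := a) (b := d) huv.ne huw.ne hne (Or.inl ha) (Or.inr hd)
    (Or.inr he) (hc.reachable huv hv ha hd) (hc.reachable huw hw ha he)

/-- The color of an edge that joins two uncolored edges is present at the far ends. -/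
lemma IsOptimal.not_missing_of_join (hc : G.IsOptimal c) (hD : D ≤ 3) (hdeg : G.DegLE D)
    {u v x y : V} {g : Fin D} (huv : G.Adj u v) (hv : c u v = none) (hxy : G.Adj x y)
    (hy : c x y = none) (hux : c u x = some g) : ¬ Missing c v g := by
  intro hg
  have hs := hc.shift huv hv hux hg
  have hxv : v ≠ x := by rintro rfl; simp [hv] at hux
  have hadj := hc.adj _ _ _ hux
  have hyu : u ≠ y := by
    rintro rfl
    rw [hc.symm, hux] at hy
    cases hy
  -- If `g` were missing at `v`, moving it from `ux` to `uv` would keep optimality but leave two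
  -- uncolored edges `xu`, `xy` at `x`.
  refine hyu (hs.matching hD hdeg hadj.symm ?_ hxy ?_)
  · rw [setEdge_of_ne (by have := hadj.ne; tauto), ← (hc.erase u x).symm, setEdge_self]
  · have := hadj.ne
    rw [setEdge_of_ne (by tauto), setEdge_of_ne (by tauto), hy]

/-- The color `g` is present at all four ends. The two ends of an uncolored edge miss disjoint
nonempty sets of colors, so the two colors other than `g` are split one to each end, on both edges.
-/
lemma IsOptimal.missingOnly_of_join (hc : G.IsOptimal c) (hD : D ≤ 3) (hdeg : G.DegLE D)
    {u v x y : V} {g : Fin D} (huv : G.Adj u v) (hv : c u v = none) (hxy : G.Adj x y)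
    (hy : c x y = none) (hux : c u x = some g) :
    ∃ a b, a ≠ b ∧ MissingOnly c u a ∧ MissingOnly c v b ∧
      (MissingOnly c x a ∧ MissingOnly c y b ∨ MissingOnly c x b ∧ MissingOnly c y a) := by
  have hxu : c x u = some g := hc.symm u x ▸ hux
  have hv' : c v u = none := hc.symm u v ▸ hv
  have hy' : c y x = none := hc.symm x y ▸ hy
  have hgv := hc.not_missing_of_join hD hdeg huv hv hxy hy hux
  have hgy := hc.not_missing_of_join hD hdeg hxy hy huv hv hxu
  have hgu : ¬ Missing c u g := fun h => h _ hux
  have hgx : ¬ Missing c x g := fun h => h _ hxu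
  obtain ⟨a, ha⟩ := hc.exists_missing hdeg huv hv
  obtain ⟨b, hb⟩ := hc.exists_missing hdeg huv.symm hv'
  obtain ⟨p, hp⟩ := hc.exists_missing hdeg hxy hy
  obtain ⟨q, hq⟩ := hc.exists_missing hdeg hxy.symm hy'
  have only : ∀ {s t : V} {d e : Fin D}, G.Adj s t → c s t = none → ¬ Missing c s g →
      ¬ Missing c t g → Missing c s d → Missing c t e → MissingOnly c s d := by
    intro s t d e hst h hgs hgt hd he k
    refine ⟨fun hk => ?_, fun hk => hk ▸ hd⟩
    have h1 : k ≠ g := by rintro rfl; exact hgs hk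
    have h2 : d ≠ g := by rintro rfl; exact hgs hd
    have h3 : e ≠ g := by rintro rfl; exact hgt he
    have h4 : d ≠ e := by rintro rfl; exact hc.not_missing hst h hd he
    have h5 : k ≠ e := by rintro rfl; exact hc.not_missing hst h hk he
    omega
  have hua := only huv hv hgu hgv ha hb
  have hvb := only huv.symm hv' hgv hgu hb ha
  have hxp := only hxy hy hgx hgy hp hq
  have hyq := only hxy.symm hy' hgy hgx hq hp
  have hab : a ≠ b := by rintro rfl; exact hc.not_missing huv hv ha hb
  have hpq : p ≠ q := by rintro rfl; exact hc.not_missing hxy hy hp hq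
  have hag : a ≠ g := by rintro rfl; exact hgu ha
  have hbg : b ≠ g := by rintro rfl; exact hgv hb
  have hpg : p ≠ g := by rintro rfl; exact hgx hp
  have hqg : q ≠ g := by rintro rfl; exact hgy hq
  refine ⟨a, b, hab, hua, hvb, ?_⟩
  have : (p = a ∧ q = b) ∨ (p = b ∧ q = a) := by omega
  rcases this with ⟨rfl, rfl⟩ | ⟨rfl, rfl⟩
  · exact Or.inl ⟨hxp, hyq⟩
  · exact Or.inr ⟨hxp, hyq⟩

/-! ### Ordering the missing colors by Kempe swaps -/

open Classical in
/-- The uncolored edges whose missing colors are not ordered as `f` prescribes. -/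
noncomputable def misorderedPairs (G : SimpleGraph V) (f : V → Fin 3)
    (c : V → V → Option (Fin D)) : Finset (V × V) :=
  Finset.univ.filter fun p => G.Adj p.1 p.2 ∧ c p.1 p.2 = none ∧ f p.2 = f p.1 + 1 ∧
    ∃ a b, b < a ∧ MissingOnly c p.1 a ∧ MissingOnly c p.2 b

lemma exists_isOptimal_forall_le (G : SimpleGraph V) (D : ℕ)
    (φ : (V → V → Option (Fin D)) → ℕ) :
    ∃ c, G.IsOptimal c ∧ ∀ c', G.IsOptimal c' → φ c ≤ φ c' := by
  obtain ⟨c, hc, hmin⟩ : ∃ c, G.IsPartialEdgeColoring c ∧ ∀ c', G.IsPartialEdgeColoring c' →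
      (G.uncoloredPairs c).card ≤ (G.uncoloredPairs (C := Fin D) c').card := by
    have : ({c | G.IsPartialEdgeColoring c} : Set (V → V → Option (Fin D))).Nonempty :=
      ⟨fun _ _ => none, ⟨fun _ _ => rfl, by simp, by simp⟩⟩
    obtain ⟨c, hc, h⟩ := exists_minimalFor_of_wellFoundedLT
      (fun c : V → V → Option (Fin D) => G.IsPartialEdgeColoring c)
      (fun c => (G.uncoloredPairs c).card) this
    exact ⟨c, hc, fun c' hc' => (le_total _ _).elim id (h hc')⟩
  obtain ⟨c, hc, h⟩ := exists_minimalFor_of_wellFoundedLT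
    (fun c : V → V → Option (Fin D) => G.IsOptimal c) φ ⟨c, hc, hmin⟩
  exact ⟨c, hc, fun c' hc' => (le_total _ _).elim id (h hc')⟩

/-- The Kempe chain joining the ends of a misordered edge has no other ends. Swapping it exchanges
the missing colors of `u` and `v` and changes the missing colors of no other vertex. -/
lemma IsOptimal.exists_lt_misorderedPairs (hc : G.IsOptimal c) (hD : D ≤ 3) (hdeg : G.DegLE D)
    (f : V → Fin 3) {u v : V} (h : (u, v) ∈ misorderedPairs G f c) :
    ∃ c' : V → V → Option (Fin D), G.IsOptimal c' ∧
      (misorderedPairs G f c').card < (misorderedPairs G f c).card := by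
  have hm := h
  simp only [misorderedPairs, Finset.mem_filter, Finset.mem_univ, true_and] at h
  obtain ⟨huv, hn, hf, a, b, hba, hua, hvb⟩ := h
  have hn' : c v u = none := hc.symm u v ▸ hn
  have hr := hc.reachable huv hn hua.missing hvb.missing
  set X : Set V := {x | (kempe c a b).Reachable u x} with hX
  have hcl : ∀ x y, (kempe c a b).Adj x y → x ∈ X → y ∈ X := reachable_closed (kempe c a b) u
  have huX : u ∈ X := Reachable.refl u
  have hvX : v ∈ X := hr
  have hsame : ∀ x, x ≠ u → x ≠ v → ∀ d,
      (Missing (kempeSwap c a b X) x d ↔ Missing c x d) := by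
    intro x hxu hxv d
    by_cases hx : x ∈ X
    · have hno : ¬ (Missing c x a ∨ Missing c x b) := fun h =>
        hc.false_of_three_ends huv.ne hxu.symm hxv.symm (Or.inl hua.missing)
          (Or.inr hvb.missing) h hr hx
      rw [hc.missing_kempeSwap hcl hx]
      by_cases hda : d = a
      · subst hda
        rw [Equiv.swap_apply_left]
        tauto
      · by_cases hdb : d = b
        · subst hdb
          rw [Equiv.swap_apply_right]
          tauto
        · rw [Equiv.swap_apply_of_ne_of_ne hda hdb]
    · exact missing_kempeSwap_of_notMem hx d
  refine ⟨kempeSwap c a b X, ⟨hc.kempeSwap hcl, ?_⟩, Finset.card_lt_card ⟨?_, ?_⟩⟩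
  · rw [uncoloredPairs_kempeSwap]
    exact hc.le
  · rintro ⟨x, y⟩ h
    simp only [misorderedPairs, Finset.mem_filter, Finset.mem_univ, true_and,
      kempeSwap_eq_none] at h ⊢
    obtain ⟨hxy, hxyn, hfxy, d, e, hed, hxd, hye⟩ := h
    have hyxn : c y x = none := hc.symm x y ▸ hxyn
    by_cases hxu : x = u
    · subst hxu
      obtain rfl := hc.matching hD hdeg hxy hxyn huv hn
      have h1 := (hxd _).1 ((hc.missing_kempeSwap hcl huX b).2
        (by rw [Equiv.swap_apply_right]; exact hua.missing))
      have h2 := (hye _).1 ((hc.missing_kempeSwap hcl hvX a).2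
        (by rw [Equiv.swap_apply_left]; exact hvb.missing))
      omega
    by_cases hxv : x = v
    · subst hxv
      obtain rfl := hc.matching hD hdeg hxy hxyn huv.symm hn'
      -- Modulo 3, `f v = f u + 1` and `f u = f v + 1` are incompatible: an edge has one
      -- orientation.
      omega
    have hyu : y ≠ u := by
      rintro rfl
      exact hxv (hc.matching hD hdeg hxy.symm hyxn huv hn)
    have hyv : y ≠ v := by
      rintro rfl
      exact hxu (hc.matching hD hdeg hxy.symm hyxn huv.symm hn')
    exact ⟨hxy, hxyn, hfxy, d, e, hed, fun k => (hsame x hxu hxv k).symm.trans (hxd k),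
      fun k => (hsame y hyu hyv k).symm.trans (hye k)⟩
  · intro h
    have h' := h hm
    simp only [misorderedPairs, Finset.mem_filter, Finset.mem_univ, true_and] at h'
    obtain ⟨-, -, -, d, e, hed, hud, hve⟩ := h'
    have h1 := (hud _).1 ((hc.missing_kempeSwap hcl huX b).2
      (by rw [Equiv.swap_apply_right]; exact hua.missing))
    have h2 := (hve _).1 ((hc.missing_kempeSwap hcl hvX a).2
      (by rw [Equiv.swap_apply_left]; exact hvb.missing))
    omega

/-- A partial edge coloring whose uncolored edges form a matching, and which distinguishes the
joined ends of two uncolored edges that are oriented in opposite ways by `f`. -/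
theorem exists_partialEdgeColoring (hD : D ≤ 3) (hdeg : G.DegLE D) (f : V → Fin 3) :
    ∃ c : V → V → Option (Fin D), G.IsPartialEdgeColoring c ∧
      (∀ u v w, G.Adj u v → c u v = none → G.Adj u w → c u w = none → v = w) ∧
      ∀ u v x y g, G.Adj u v → c u v = none → G.Adj x y → c x y = none → c u x = some g →
        f v = f u + 1 → f x = f y + 1 → ∃ d, Missing c u d ∧ ¬ Missing c x d := by
  obtain ⟨c, hc, hmin⟩ := exists_isOptimal_forall_le G D fun c => (misorderedPairs G f c).card
  have hlt : ∀ u v a b, G.Adj u v → c u v = none → f v = f u + 1 → MissingOnly c u a →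
      MissingOnly c v b → ¬ b < a := by
    intro u v a b huv h hf hu hv hba
    obtain ⟨c', hc', hlt⟩ := hc.exists_lt_misorderedPairs hD hdeg f (u := u) (v := v) (by
      simp only [misorderedPairs, Finset.mem_filter, Finset.mem_univ, true_and]
      exact ⟨huv, h, hf, a, b, hba, hu, hv⟩)
    exact absurd (hmin c' hc') (not_le.2 hlt)
  refine ⟨c, hc.toIsPartialEdgeColoring, fun u v w huv hv huw hw =>
    hc.matching hD hdeg huv hv huw hw, ?_⟩
  intro u v x y g huv hv hxy hy hux hfu hfx
  obtain ⟨a, b, hab, hua, hvb, h⟩ := hc.missingOnly_of_join hD hdeg huv hv hxy hy hux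
  have h1 := hlt u v a b huv hv hfu hua hvb
  refine ⟨a, hua.missing, fun ha => ?_⟩
  rcases h with ⟨hx, hy'⟩ | ⟨hx, hy'⟩
  · have := hlt y x b a hxy.symm (hc.symm x y ▸ hy) hfx hy' hx
    omega
  · exact hab ((hx a).1 ha)

end

/-! ### Total colorings of properly 3-colored subcubic graphs -/

/-- The colors of `u` and of the edges at `u`. -/
def seen {V : Type*} (G : SimpleGraph V) (cv : V → ℕ) (ce : V → V → ℕ) (u : V) : Set ℕ :=
  {a | cv u = a ∨ ∃ w, G.Adj u w ∧ ce u w = a}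

/-- `cv` and `ce` are the vertex part and the edge part of a neighbor set distinguishing total
coloring. -/
structure IsDistinguishing {V : Type*} (G : SimpleGraph V) (k : ℕ) (cv : V → ℕ)
    (ce : V → V → ℕ) : Prop where
  symm : ∀ u v, G.Adj u v → ce u v = ce v u
  vertex_mem : ∀ v, cv v ∈ Set.Icc 1 k
  edge_mem : ∀ u v, G.Adj u v → ce u v ∈ Set.Icc 1 k
  vertex_ne : ∀ u v, G.Adj u v → cv u ≠ cv v
  vertex_ne_edge : ∀ u v, G.Adj u v → cv u ≠ ce u v
  edge_ne : ∀ u v w, G.Adj u v → G.Adj u w → v ≠ w → ce u v ≠ ce u w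
  seen_ne : ∀ u v, G.Adj u v → G.seen cv ce u ≠ G.seen cv ce v

lemma IsDistinguishing.exists_isNeighborSetDistinguishing {V : Type*} {G : SimpleGraph V} {k : ℕ}
    {cv : V → ℕ} {ce : V → V → ℕ} (h : G.IsDistinguishing k cv ce) :
    ∃ c, G.IsNeighborSetDistinguishing k c := by
  classical
  obtain ⟨φ, hφ⟩ : ∃ φ : Sym2 V → ℕ, ∀ u v, G.Adj u v → φ s(u, v) = ce u v := by
    refine ⟨Sym2.lift ⟨fun u v => if G.Adj u v then ce u v else 0, fun u v => ?_⟩,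
      fun u v huv => by simp [huv]⟩
    by_cases huv : G.Adj u v
    · simp [huv, huv.symm, h.symm u v huv]
    · have : ¬ G.Adj v u := fun h => huv h.symm
      simp [huv, this]
  have hE : ∀ (e : G.edgeSet) (u : V), u ∈ (e : Sym2 V) →
      ∃ v, G.Adj u v ∧ (e : Sym2 V) = s(u, v) := by
    rintro ⟨e, he⟩ u hu
    obtain ⟨v, rfl⟩ := Sym2.mem_iff_exists.1 hu
    exact ⟨v, he, rfl⟩
  have hseen : ∀ u, G.colorSet (Sum.elim cv fun e => φ e) u = G.seen cv ce u := by
    intro u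
    ext a
    simp only [colorSet, seen, Set.mem_insert_iff, Set.mem_ofPred_eq, Sum.elim_inl, Sum.elim_inr]
    refine or_congr eq_comm ⟨?_, ?_⟩
    · rintro ⟨e, he, rfl⟩
      obtain ⟨v, huv, hev⟩ := hE e u he
      exact ⟨v, huv, by rw [hev, hφ u v huv]⟩
    · rintro ⟨v, huv, rfl⟩
      exact ⟨⟨s(u, v), huv⟩, Sym2.mem_mk_left u v, hφ u v huv⟩
  refine ⟨Sum.elim cv fun e => φ e, ⟨?_, ?_⟩, fun u v huv => ?_⟩
  · rintro (v | ⟨e, he⟩)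
    · exact h.vertex_mem v
    · induction e using Sym2.ind with
      | _ u v => simpa only [Sum.elim_inr, hφ u v he] using h.edge_mem u v he
  · rintro (u | e) (v | e') hc
    · exact h.vertex_ne u v hc
    · obtain ⟨v, huv, hev⟩ := hE e' u hc
      simpa only [Sum.elim_inl, Sum.elim_inr, hev, hφ u v huv] using h.vertex_ne_edge u v huv
    · obtain ⟨u, huv, hev⟩ := hE e v hc
      simpa only [Sum.elim_inl, Sum.elim_inr, hev, hφ v u huv] using
        (h.vertex_ne_edge v u huv).symm
    · obtain ⟨hne, v, hv, hv'⟩ := hc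
      obtain ⟨x, hvx, hx⟩ := hE e v hv
      obtain ⟨y, hvy, hy⟩ := hE e' v hv'
      simp only [Sum.elim_inr, hx, hy, hφ v x hvx, hφ v y hvy]
      refine h.edge_ne v x y hvx hvy ?_
      rintro rfl
      exact hne (Subtype.ext (hx.trans hy.symm))
  · rw [hseen, hseen]
    exact h.seen_ne u v huv

/-- The color of an edge for which `c` is used where it is defined, and otherwise the color of
`{1, 2, 3}` that is not used by the ends. -/
def edgeColor {V : Type*} {D : ℕ} (f : V → Fin 3) (c : V → V → Option (Fin D)) (u v : V) : ℕ :=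
  match c u v with
  | some d => d + 4
  | none => (-(f u + f v)).val + 1

lemma edgeColor_some {V : Type*} {D : ℕ} {f : V → Fin 3} {c : V → V → Option (Fin D)} {u v : V}
    {d : Fin D} (h : c u v = some d) : edgeColor f c u v = d + 4 := by
  simp [edgeColor, h]

lemma edgeColor_none {V : Type*} {D : ℕ} {f : V → Fin 3} {c : V → V → Option (Fin D)} {u v : V}
    (h : c u v = none) : edgeColor f c u v = (-(f u + f v)).val + 1 := by
  simp [edgeColor, h]

/-- Vertices and edges left uncolored by `c` receive colors at most 3, so the colors from 4 on
record exactly what `c` uses at `u`. -/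
lemma mem_seen_edgeColor {V : Type*} {G : SimpleGraph V} {D : ℕ} {f : V → Fin 3}
    {c : V → V → Option (Fin D)} (hc : G.IsPartialEdgeColoring c) (u : V) (d : Fin D) :
    (d : ℕ) + 4 ∈ G.seen (fun v => (f v).val + 1) (edgeColor f c) u ↔ ¬ Missing c u d := by
  simp only [seen, Set.mem_ofPred_eq, Missing, not_forall, not_not]
  constructor
  · rintro (h | ⟨w, -, h⟩)
    · omega
    · refine ⟨w, ?_⟩
      cases hw : c u w with
      | none =>
        rw [edgeColor_none hw] at h
        omega
      | some e =>
        rw [edgeColor_some hw] at h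
        exact congrArg some (Fin.ext (by omega))
  · rintro ⟨w, hw⟩
    exact Or.inr ⟨w, hc.adj _ _ _ hw, edgeColor_some hw⟩

/-- A color at most 3 that is not the vertex's own comes from an uncolored edge. The three residues
modulo 3 sum to zero, so `-(f u + f w)` is the one different from both ends. -/
lemma exists_of_mem_seen_edgeColor {V : Type*} {G : SimpleGraph V} {D : ℕ} {f : V → Fin 3}
    {c : V → V → Option (Fin D)} {u : V} {i : Fin 3} (hi : f u ≠ i)
    (h : (i : ℕ) + 1 ∈ G.seen (fun v => (f v).val + 1) (edgeColor f c) u) :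
    ∃ w, G.Adj u w ∧ c u w = none ∧ -(f u + f w) = i := by
  rcases h with h | ⟨w, huw, h⟩
  · exact (hi (Fin.ext (by simpa using h))).elim
  · refine ⟨w, huw, ?_⟩
    cases hw : c u w with
    | none =>
      rw [edgeColor_none hw] at h
      exact ⟨rfl, Fin.ext (by omega)⟩
    | some e =>
      rw [edgeColor_some hw] at h
      omega

/-- A properly `3`-colored graph of maximum degree at most `D ≤ 3` has a neighbor set
distinguishing total coloring with `D + 3` colors. -/
theorem exists_isDistinguishing_of_properOn {V : Type*} [Fintype V] {G : SimpleGraph V} {D : ℕ}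
    (hD : D ≤ 3) (hdeg : G.DegLE D) {f : V → Fin 3} (hf : G.ProperOn Set.univ f) :
    ∃ cv ce, G.IsDistinguishing (D + 3) cv ce := by
  obtain ⟨c, hc, hmatch, hjoin⟩ := exists_partialEdgeColoring hD hdeg f
  have hf' : ∀ u v, G.Adj u v → f u ≠ f v := fun u v => hf u trivial v trivial
  refine ⟨fun v => (f v).val + 1, edgeColor f c, ?_, ?_, ?_, ?_, ?_, ?_, ?_⟩
  · intro u v _
    unfold edgeColor
    rw [hc.symm u v, add_comm (f u)]
  · intro v
    simp only [Set.mem_Icc]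
    omega
  · intro u v _
    simp only [Set.mem_Icc]
    cases h : c u v with
    | none =>
      rw [edgeColor_none h]
      omega
    | some d =>
      rw [edgeColor_some h]
      omega
  · intro u v huv h
    exact hf' u v huv (Fin.ext (by simpa using h))
  · intro u v huv h
    cases hn : c u v with
    | none =>
      rw [edgeColor_none hn] at h
      have h1 : f u = -(f u + f v) := Fin.ext (by omega)
      have h2 := hf' u v huv
      revert h1 h2
      generalize f u = i
      generalize f v = j
      revert i j
      decide
    | some d =>
      rw [edgeColor_some hn] at h
      omega
  · intro u v w huv huw hvw h
    cases hv : c u v with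
    | none =>
      cases hw : c u w with
      | none => exact hvw (hmatch u v w huv hv huw hw)
      | some e =>
        rw [edgeColor_none hv, edgeColor_some hw] at h
        omega
    | some d =>
      cases hw : c u w with
      | none =>
        rw [edgeColor_some hv, edgeColor_none hw] at h
        omega
      | some e =>
        rw [edgeColor_some hv, edgeColor_some hw] at h
        obtain rfl : d = e := Fin.ext (by omega)
        exact hvw (hc.proper u v w d hv hw)
  · intro u v huv h
    have hne := hf' u v huv
    obtain ⟨x, hux, hx, hfx⟩ := exists_of_mem_seen_edgeColor (G := G) (c := c) hne
      (h ▸ Or.inl rfl : ((f v : Fin 3) : ℕ) + 1 ∈ G.seen _ (edgeColor f c) u)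
    obtain ⟨y, hvy, hy, hfy⟩ := exists_of_mem_seen_edgeColor (G := G) (c := c) hne.symm
      (h ▸ Or.inl rfl : ((f u : Fin 3) : ℕ) + 1 ∈ G.seen _ (edgeColor f c) v)
    -- Both `f x` and `f y` are the third residue, so in the cyclic order one of `ux`, `vy` points
    -- away from `uv` and the other toward it.
    have hor : (f x = f u + 1 ∧ f v = f y + 1) ∨ (f y = f v + 1 ∧ f u = f x + 1) := by
      have : ∀ i j k l : Fin 3, i ≠ j → -(i + k) = j → -(j + l) = i →
          (k = i + 1 ∧ j = l + 1) ∨ (l = j + 1 ∧ i = k + 1) := by decide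
      exact this _ _ _ _ hne hfx hfy
    cases hn : c u v with
    | none =>
      obtain rfl := hmatch u v x huv hn hux hx
      have : ∀ i j : Fin 3, i ≠ j → -(i + j) ≠ j := by decide
      exact this _ _ hne hfx
    | some g =>
      rcases hor with ⟨h1, h2⟩ | ⟨h1, h2⟩
      · obtain ⟨d, hd, hd'⟩ := hjoin u x v y g hux hx hvy hy hn h1 h2
        rw [← mem_seen_edgeColor hc v d (f := f), ← h, mem_seen_edgeColor hc] at hd'
        exact hd' hd
      · obtain ⟨d, hd, hd'⟩ := hjoin v y u x g hvy hy hux hx (hc.symm u v ▸ hn) h1 h2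
        rw [← mem_seen_edgeColor hc u d (f := f), h, mem_seen_edgeColor hc] at hd'
        exact hd' hd

/-! ### Components that are complete graphs on four vertices -/

/-- The vertex colors of a neighbor set distinguishing total coloring of `K₄`. -/
def completeVertexColor : Fin 4 → ℕ := ![4, 5, 1, 2]

/-- The edge colors of a neighbor set distinguishing total coloring of `K₄`. -/
def completeEdgeColor : Fin 4 → Fin 4 → ℕ :=
  ![![0, 1, 2, 3], ![1, 0, 3, 4], ![2, 3, 0, 5], ![3, 4, 5, 0]]

/-- The edge `ij` has color i + j. Each vertex sees four of the colors 1, …, 5; the vertices 0, 1,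
2, 3 miss 5, 2, 4, 1 respectively. -/
lemma completeColor_distinguishes : ∀ i j : Fin 4, i ≠ j → ∃ a ∈ Finset.range 6,
    ¬ ((completeVertexColor i = a ∨ ∃ l, l ≠ i ∧ completeEdgeColor i l = a) ↔
      (completeVertexColor j = a ∨ ∃ l, l ≠ j ∧ completeEdgeColor j l = a)) := by
  decide

/-- In a graph of maximum degree three, a vertex of a `4`-clique has no neighbours outside it. -/
lemma IsNClique.mem_of_adj {V : Type*} {G : SimpleGraph V} (hdeg : G.DegLE 3) {s : Finset V}
    (hs : G.IsNClique 4 s) {u v : V} (hu : u ∈ s) (huv : G.Adj u v) : v ∈ s := by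
  classical
  by_contra hv
  have h := hdeg u (insert v (s.erase u)) (by
    intro w hw
    rcases Finset.mem_insert.1 hw with rfl | hw
    · exact huv
    · obtain ⟨hwu, hws⟩ := Finset.mem_erase.1 hw
      exact hs.isClique hu hws hwu.symm)
  rw [Finset.card_insert_of_notMem (by simp [hv]), Finset.card_erase_of_mem hu, hs.card_eq] at h
  omega

/-- A graph of maximum degree at most `D ≤ 3` has a neighbor set distinguishing total coloring
with `D + 3` colors. -/
theorem exists_isDistinguishing {V : Type*} [Fintype V] {G : SimpleGraph V} {D : ℕ}
    (hD : D ≤ 3) (hdeg : G.DegLE D) : ∃ cv ce, G.IsDistinguishing (D + 3) cv ce := by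
  classical
  have hdeg3 : G.DegLE 3 := fun v T hT => (hdeg v T hT).trans hD
  by_cases hK : G.CliqueFree 4
  · obtain ⟨f, hf⟩ := exists_properOn_of_cliqueFree hdeg3 hK
    exact exists_isDistinguishing_of_properOn hD hdeg hf
  obtain rfl : D = 3 := by
    unfold CliqueFree at hK
    push Not at hK
    obtain ⟨s, hs⟩ := hK
    obtain ⟨u, hu⟩ := Finset.card_pos.1 (by rw [hs.card_eq]; norm_num : 0 < s.card)
    have := hdeg u (s.erase u) (by
      intro w hw
      obtain ⟨hwu, hws⟩ := Finset.mem_erase.1 hw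
      exact hs.isClique hu hws hwu.symm)
    rw [Finset.card_erase_of_mem hu, hs.card_eq] at this
    omega
  set Q : Set V := {v | ∃ s, G.IsNClique 4 s ∧ v ∈ s} with hQ
  have hQadj : ∀ u v, G.Adj u v → u ∈ Q → v ∈ Q := by
    rintro u v huv ⟨s, hs, hu⟩
    exact ⟨s, hs, hs.mem_of_adj hdeg hu huv⟩
  -- The vertices of `Q` are kept but isolated, so that `G'` lives on the same type; no edge of `G`
  -- joins `Q` to its complement.
  let G' : SimpleGraph V :=
    { Adj := fun u v => G.Adj u v ∧ u ∉ Q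
      symm := ⟨fun u v h => ⟨h.1.symm, fun hv => h.2 (hQadj v u h.1.symm hv)⟩⟩
      loopless := ⟨fun u h => G.irrefl h.1⟩ }
  have hle : G' ≤ G := fun u v h => h.1
  have hG' : G'.CliqueFree 4 := by
    intro s hs
    obtain ⟨u, hu, v, hv, huv⟩ := Finset.one_lt_card.1 (by rw [hs.card_eq]; norm_num : 1 < s.card)
    exact (hs.isClique hu hv huv).2 ⟨s, hs.mono hle, hu⟩
  have hdeg' : G'.DegLE 3 := fun v T hT => hdeg v T fun w hw => (hT w hw).1
  obtain ⟨f, hf⟩ := exists_properOn_of_cliqueFree hdeg' hG'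
  obtain ⟨cv, ce, hcol⟩ := exists_isDistinguishing_of_properOn le_rfl hdeg' hf
  -- A proper 4-coloring labels the vertices of each 4-clique bijectively by `Fin 4`, with no choice
  -- of bijections.
  obtain ⟨lab, hlab⟩ := hdeg.exists_properOn_univ
  have hlab' : ∀ u v, G.Adj u v → lab u ≠ lab v := fun u v => hlab u trivial v trivial
  have hinj : ∀ u ∈ Q, ∀ v w, G.Adj u v → G.Adj u w → v ≠ w → lab v ≠ lab w := by
    rintro u ⟨s, hs, hu⟩ v w huv huw hvw
    exact hlab' v w (hs.isClique (hs.mem_of_adj hdeg hu huv) (hs.mem_of_adj hdeg hu huw) hvw)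
  have hsurj : ∀ u ∈ Q, ∀ i, i ≠ lab u → ∃ w, G.Adj u w ∧ lab w = i := by
    rintro u ⟨s, hs, hu⟩ i hi
    have himg : s.image lab = Finset.univ := by
      apply Finset.eq_univ_of_card
      rw [Finset.card_image_of_injOn, hs.card_eq, Fintype.card_fin]
      intro x hx y hy hxy
      by_contra hne
      exact hlab' x y (hs.isClique hx hy hne) hxy
    obtain ⟨w, hw, rfl⟩ := Finset.mem_image.1 (himg ▸ Finset.mem_univ i)
    exact ⟨w, hs.isClique hu hw fun h => hi (h ▸ rfl), rfl⟩
  set cv' : V → ℕ := fun v => if v ∈ Q then completeVertexColor (lab v) else cv v with hcv'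
  set ce' : V → V → ℕ := fun u v =>
    if u ∈ Q then completeEdgeColor (lab u) (lab v) else ce u v with hce'
  have hnQ : ∀ u v, G.Adj u v → u ∉ Q → v ∉ Q := fun u v h hu hv => hu (hQadj v u h.symm hv)
  have hseenQ : ∀ u ∈ Q, ∀ a, a ∈ G.seen cv' ce' u ↔
      (completeVertexColor (lab u) = a ∨ ∃ l, l ≠ lab u ∧ completeEdgeColor (lab u) l = a) := by
    intro u hu a
    simp only [seen, Set.mem_ofPred_eq, hcv', hce', if_pos hu]
    refine or_congr Iff.rfl ⟨?_, ?_⟩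
    · rintro ⟨w, huw, h⟩
      exact ⟨lab w, (hlab' u w huw).symm, h⟩
    · rintro ⟨l, hl, h⟩
      obtain ⟨w, huw, rfl⟩ := hsurj u hu l hl
      exact ⟨w, huw, h⟩
  have hseen : ∀ u, u ∉ Q → G.seen cv' ce' u = G'.seen cv ce u := by
    intro u hu
    ext a
    simp only [seen, Set.mem_ofPred_eq, hcv', hce', if_neg hu]
    exact or_congr Iff.rfl (exists_congr fun w => and_congr ⟨fun h => ⟨h, hu⟩, fun h => h.1⟩ Iff.rfl)
  refine ⟨cv', ce', ?_, ?_, ?_, ?_, ?_, ?_, ?_⟩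
  · intro u v huv
    by_cases hu : u ∈ Q
    · simp only [hce', if_pos hu, if_pos (hQadj u v huv hu)]
      have : ∀ i j, completeEdgeColor i j = completeEdgeColor j i := by decide
      exact this _ _
    · simp only [hce', if_neg hu, if_neg (hnQ u v huv hu)]
      exact hcol.symm u v ⟨huv, hu⟩
  · intro v
    by_cases hv : v ∈ Q
    · simp only [hcv', if_pos hv, Set.mem_Icc]
      have : ∀ i, 1 ≤ completeVertexColor i ∧ completeVertexColor i ≤ 3 + 3 := by decide
      exact this _
    · simp only [hcv', if_neg hv]
      exact hcol.vertex_mem v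
  · intro u v huv
    by_cases hu : u ∈ Q
    · simp only [hce', if_pos hu, Set.mem_Icc]
      have : ∀ i j, i ≠ j → 1 ≤ completeEdgeColor i j ∧ completeEdgeColor i j ≤ 3 + 3 := by decide
      exact this _ _ (hlab' u v huv)
    · simp only [hce', if_neg hu]
      exact hcol.edge_mem u v ⟨huv, hu⟩
  · intro u v huv
    by_cases hu : u ∈ Q
    · simp only [hcv', if_pos hu, if_pos (hQadj u v huv hu)]
      have : ∀ i j, i ≠ j → completeVertexColor i ≠ completeVertexColor j := by decide
      exact this _ _ (hlab' u v huv)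
    · simp only [hcv', if_neg hu, if_neg (hnQ u v huv hu)]
      exact hcol.vertex_ne u v ⟨huv, hu⟩
  · intro u v huv
    by_cases hu : u ∈ Q
    · simp only [hcv', hce', if_pos hu]
      have : ∀ i j, i ≠ j → completeVertexColor i ≠ completeEdgeColor i j := by decide
      exact this _ _ (hlab' u v huv)
    · simp only [hcv', hce', if_neg hu]
      exact hcol.vertex_ne_edge u v ⟨huv, hu⟩
  · intro u v w huv huw hvw
    by_cases hu : u ∈ Q
    · simp only [hce', if_pos hu]
      have : ∀ i j k, j ≠ k → completeEdgeColor i j ≠ completeEdgeColor i k := by decide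
      exact this _ _ _ (hinj u hu v w huv huw hvw)
    · simp only [hce', if_neg hu]
      exact hcol.edge_ne u v w ⟨huv, hu⟩ ⟨huw, hu⟩ hvw
  · intro u v huv h
    by_cases hu : u ∈ Q
    · obtain ⟨a, -, ha⟩ := completeColor_distinguishes _ _ (hlab' u v huv)
      rw [← hseenQ u hu, ← hseenQ v (hQadj u v huv hu), h] at ha
      exact ha Iff.rfl
    · rw [hseen u hu, hseen v (hnQ u v huv hu)] at h
      exact hcol.seen_ne u v ⟨huv, hu⟩ h

/-! ### Gluing colorings of G and of the copies of H -/

/-- A total coloring of `H` that can be used on a copy of `H` in a corona: the center has the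
color `b`, and the edge from the center to the vertex `w` has the color `α w`. -/
structure IsCopyColoring {W : Type*} (H : SimpleGraph W) (k b : ℕ) (α : W → ℕ) (hv : W → ℕ)
    (he : W → W → ℕ) : Prop where
  symm : ∀ w w', he w w' = he w' w
  vertex_mem : ∀ w, hv w ∈ Set.Icc 1 k
  edge_mem : ∀ w w', H.Adj w w' → he w w' ∈ Set.Icc 1 k
  vertex_ne_center : ∀ w, hv w ≠ b
  vertex_ne_pendant : ∀ w, hv w ≠ α w
  edge_ne_pendant : ∀ w w', H.Adj w w' → he w w' ≠ α w
  vertex_ne : ∀ w w', H.Adj w w' → hv w ≠ hv w'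
  vertex_ne_edge : ∀ w w', H.Adj w w' → hv w ≠ he w w'
  edge_ne : ∀ w w' w'', H.Adj w w' → H.Adj w w'' → w' ≠ w'' → he w w' ≠ he w w''
  seen_ne : ∀ w w', H.Adj w w' →
    insert (α w) (H.seen hv he w) ≠ insert (α w') (H.seen hv he w')
  -- The center sees `b` and all of `range α`; one such color absent at `w` separates them.
  center_seen : ∀ w, ∃ a, (a = b ∨ a ∈ Set.range α) ∧ a ∉ insert (α w) (H.seen hv he w)

/-- The edge colors of the corona. -/
def coronaEdgeColor {V W : Type*} (ce : V → V → ℕ) (α : W → ℕ) (he : V → W → W → ℕ) :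
    V ⊕ V × W → V ⊕ V × W → ℕ
  | Sum.inl v, Sum.inl v' => ce v v'
  | Sum.inl _, Sum.inr p => α p.2
  | Sum.inr p, Sum.inl _ => α p.2
  | Sum.inr p, Sum.inr q => he p.1 p.2 q.2

/-- A coloring of `G` and colorings of the copies of `H` give a coloring of the corona. -/
theorem IsDistinguishing.corona {V W : Type*} {G : SimpleGraph V} {H : SimpleGraph W} {m k : ℕ}
    {cv : V → ℕ} {ce : V → V → ℕ} (hG : G.IsDistinguishing m cv ce) (hmk : m ≤ k)
    {α : W → ℕ} (hα : Function.Injective α) (hαm : ∀ w, m < α w ∧ α w ≤ k)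
    {hv : V → W → ℕ} {he : V → W → W → ℕ}
    (hH : ∀ v, H.IsCopyColoring k (cv v) α (hv v) (he v)) :
    (G.corona H).IsDistinguishing k (Sum.elim cv fun p => hv p.1 p.2)
      (coronaEdgeColor ce α he) := by
  have hcv : ∀ v w, cv v ≠ α w := fun v w => by
    have := (hG.vertex_mem v).2
    have := hαm w
    omega
  have hce : ∀ v v' w, G.Adj v v' → ce v v' ≠ α w := fun v v' w h => by
    have := (hG.edge_mem v v' h).2
    have := hαm w
    omega
  have seen_inl : ∀ v, (G.corona H).seen (Sum.elim cv fun p => hv p.1 p.2)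
      (coronaEdgeColor ce α he) (Sum.inl v) = G.seen cv ce v ∪ Set.range α := by
    intro v
    ext a
    simp only [seen, Set.mem_ofPred_eq, Set.mem_union, Set.mem_range, Sum.elim_inl]
    constructor
    · rintro (h | ⟨v' | p, hadj, h⟩)
      · exact Or.inl (Or.inl h)
      · exact Or.inl (Or.inr ⟨v', hadj, h⟩)
      · exact Or.inr ⟨p.2, h⟩
    · rintro ((h | ⟨v', hadj, h⟩) | ⟨w, h⟩)
      · exact Or.inl h
      · exact Or.inr ⟨Sum.inl v', hadj, h⟩
      · exact Or.inr ⟨Sum.inr (v, w), rfl, h⟩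
  have seen_inr : ∀ v w, (G.corona H).seen (Sum.elim cv fun p => hv p.1 p.2)
      (coronaEdgeColor ce α he) (Sum.inr (v, w)) = insert (α w) (H.seen (hv v) (he v) w) := by
    intro v w
    ext a
    simp only [seen, Set.mem_ofPred_eq, Set.mem_insert_iff, Sum.elim_inr]
    constructor
    · rintro (h | ⟨v' | ⟨v', w'⟩, hadj, h⟩)
      · exact Or.inr (Or.inl h)
      · exact Or.inl h.symm
      · obtain ⟨h1, h2⟩ := hadj
        exact Or.inr (Or.inr ⟨w', h2, h⟩)
    · rintro (h | h | ⟨w', hadj, h⟩)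
      · exact Or.inr ⟨Sum.inl v, rfl, h.symm⟩
      · exact Or.inl h
      · exact Or.inr ⟨Sum.inr (v, w'), ⟨rfl, hadj⟩, h⟩
  have center : ∀ v w, G.seen cv ce v ∪ Set.range α ≠
      insert (α w) (H.seen (hv v) (he v) w) := by
    intro v w h
    obtain ⟨a, ha, hna⟩ := (hH v).center_seen w
    rw [← h] at hna
    rcases ha with rfl | ha
    · exact hna (Or.inl (Or.inl rfl))
    · exact hna (Or.inr ha)
  refine ⟨?_, ?_, ?_, ?_, ?_, ?_, ?_⟩
  · rintro (v | ⟨v, w⟩) (v' | ⟨v', w'⟩) h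
    · exact hG.symm v v' h
    · rfl
    · rfl
    · obtain ⟨h1, h2⟩ := h
      obtain rfl : v = v' := h1
      exact (hH v).symm w w'
  · rintro (v | ⟨v, w⟩)
    · have := hG.vertex_mem v
      exact ⟨this.1, this.2.trans hmk⟩
    · exact (hH v).vertex_mem w
  · have hαk : ∀ w, α w ∈ Set.Icc 1 k := fun w => ⟨by have := hαm w; omega, (hαm w).2⟩
    rintro (v | ⟨v, w⟩) (v' | ⟨v', w'⟩) h
    · have := hG.edge_mem v v' h
      exact ⟨this.1, this.2.trans hmk⟩
    · exact hαk w'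
    · exact hαk w
    · exact (hH v).edge_mem w w' h.2
  · rintro (v | ⟨v, w⟩) (v' | ⟨v', w'⟩) h
    · exact hG.vertex_ne v v' h
    · obtain rfl : v = v' := h
      exact ((hH v).vertex_ne_center w').symm
    · obtain rfl : v' = v := h
      exact (hH v').vertex_ne_center w
    · obtain ⟨h1, h2⟩ := h
      obtain rfl : v = v' := h1
      exact (hH v).vertex_ne w w' h2
  · rintro (v | ⟨v, w⟩) (v' | ⟨v', w'⟩) h
    · exact hG.vertex_ne_edge v v' h
    · exact hcv v w'
    · exact (hH v).vertex_ne_pendant w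
    · exact (hH v).vertex_ne_edge w w' h.2
  · rintro (v | ⟨v, w⟩) (v' | ⟨v', w'⟩) (v'' | ⟨v'', w''⟩) h h' hne
    · exact hG.edge_ne v v' v'' h h' fun e => hne (congrArg Sum.inl e)
    · exact hce v v' w'' h
    · exact (hce v v'' w' h').symm
    · obtain rfl : v = v' := h
      obtain rfl : v = v'' := h'
      exact fun e => hne (by rw [show w' = w'' from hα e])
    · obtain rfl : v' = v := h
      obtain rfl : v'' = v' := h'
      exact (hne rfl).elim
    · exact ((hH v).edge_ne_pendant w w'' h'.2).symm
    · exact (hH v).edge_ne_pendant w w' h.2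
    · obtain ⟨h1, h2⟩ := h
      obtain ⟨h3, h4⟩ := h'
      obtain rfl : v = v' := h1
      obtain rfl : v = v'' := h3
      exact (hH v).edge_ne w w' w'' h2 h4 fun e => hne (by rw [e])
  · rintro (v | ⟨v, w⟩) (v' | ⟨v', w'⟩) h
    · rw [seen_inl, seen_inl]
      intro heq
      refine hG.seen_ne v v' h ?_
      -- Pendant colors exceed `m`, so truncating at `m` recovers the color set in `G`.
      have key : ∀ x, G.seen cv ce x = (G.seen cv ce x ∪ Set.range α) ∩ Set.Iic m := by
        intro x
        ext a
        constructor
        · intro ha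
          refine ⟨Or.inl ha, ?_⟩
          rcases ha with rfl | ⟨y, hxy, rfl⟩
          · exact (hG.vertex_mem x).2
          · exact (hG.edge_mem x y hxy).2
        · rintro ⟨ha | ⟨w, rfl⟩, ham⟩
          · exact ha
          · exact absurd (hαm w).1 (not_lt.2 ham)
      rw [key v, key v', heq]
    · obtain rfl : v = v' := h
      rw [seen_inl, seen_inr]
      exact center v w'
    · obtain rfl : v' = v := h
      rw [seen_inl, seen_inr]
      exact (center v' w).symm
    · obtain ⟨h1, h2⟩ := h
      obtain rfl : v = v' := h1
      rw [seen_inr, seen_inr]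
      exact (hH v).seen_ne w w' h2

/-! ### Colorings of the copies of H -/

/-- Copies with at most two vertices. -/
lemma exists_isCopyColoring_of_card_le_two {W : Type*} [Fintype W] (H : SimpleGraph W)
    (hW : Fintype.card W ≤ 2) {k b : ℕ} {α : W → ℕ} (hα : Function.Injective α)
    (hα3 : ∀ w, 3 < α w ∧ α w ≤ k) (hb : ∀ w, b < α w) :
    ∃ hv he, H.IsCopyColoring k b α hv he := by
  classical
  obtain ⟨g⟩ : Nonempty (W ↪ (({1, 2, 3} : Finset ℕ).erase b : Finset ℕ)) := by
    apply Function.Embedding.nonempty_of_card_le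
    rw [Fintype.card_coe]
    have : ({1, 2, 3} : Finset ℕ).card = 3 := rfl
    have := Finset.pred_card_le_card_erase (s := ({1, 2, 3} : Finset ℕ)) (a := b)
    omega
  have hg : ∀ w, (g w : ℕ) ≠ b ∧ 1 ≤ (g w : ℕ) ∧ (g w : ℕ) ≤ 3 := by
    intro w
    have := (g w).2
    simp only [Finset.mem_erase, Finset.mem_insert, Finset.mem_singleton] at this
    omega
  have hne : ∀ w w', w ≠ w' → (g w : ℕ) ≠ g w' :=
    fun w w' h e => h (g.injective (Subtype.ext e))
  have hthree : ∀ x y z : W, x ≠ y → x ≠ z → y ≠ z → False := by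
    intro x y z h1 h2 h3
    have h4 := Finset.card_le_univ ({x, y, z} : Finset W)
    rw [Finset.card_eq_three.2 ⟨x, y, z, h1, h2, h3, rfl⟩] at h4
    omega
  have hnot : ∀ w w', w ≠ w' → α w ∉ insert (α w')
      (H.seen (fun w => (g w : ℕ)) (fun w w' => 6 - g w - g w') w') := by
    intro w w' hww' h
    have := hα3 w
    rcases h with h | h | ⟨x, hx, h⟩
    · exact hww' (hα h)
    · have := hg w'
      have : (g w' : ℕ) = α w := h
      omega
    · have := hg w'
      have := hg x
      have := hne _ _ hx.ne
      have : 6 - (g w' : ℕ) - g x = α w := h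
      omega
  -- Since 1 + 2 + 3 = 6, the edge gets the third color of {1, 2, 3}. This may be `b`, as edges of
  -- the copy do not meet the center.
  refine ⟨fun w => g w, fun w w' => 6 - g w - g w', ?_, ?_, ?_, ?_, ?_, ?_, ?_, ?_, ?_, ?_, ?_⟩
  · intro w w'
    omega
  · intro w
    have := hα3 w
    exact ⟨(hg w).2.1, (hg w).2.2.trans (by omega)⟩
  · intro w w' h
    have := hg w
    have := hg w'
    have := hα3 w
    have := hne _ _ h.ne
    simp only [Set.mem_Icc]
    omega
  · exact fun w => (hg w).1
  · intro w
    have := hg w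
    have := hα3 w
    omega
  · intro w w' h
    have := hg w
    have := hg w'
    have := hα3 w
    have := hne _ _ h.ne
    omega
  · exact fun w w' h => hne _ _ h.ne
  · intro w w' h
    have := hg w
    have := hg w'
    have := hne _ _ h.ne
    omega
  · exact fun w w' w'' h h' hne => (hthree w w' w'' h.ne h'.ne hne).elim
  · intro w w' h heq
    exact hnot w w' h.ne (heq ▸ Set.mem_insert _ _)
  · intro w
    by_cases hex : ∃ w', w' ≠ w
    · obtain ⟨w', hw'⟩ := hex
      exact ⟨α w', Or.inr ⟨w', rfl⟩, hnot w' w hw'⟩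
    · push Not at hex
      -- In a one-vertex copy `w` sees all of `range α`, so the center's own color must separate.
      refine ⟨b, Or.inl rfl, ?_⟩
      rintro (h | h | ⟨x, hx, -⟩)
      · exact absurd h (hb w).ne
      · exact (hg w).1 h
      · exact hx.ne (hex x).symm

/-- A permutation without orbits of length one or two that maps `x` to `y`. -/
lemma exists_perm_without_short_cycles {W : Type*} [Fintype W] (hW : 3 ≤ Fintype.card W)
    {x y : W} (hxy : x ≠ y) :
    ∃ σ : Equiv.Perm W, (∀ w, σ w ≠ w) ∧ (∀ w, σ (σ w) ≠ w) ∧ σ x = y := by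
  classical
  obtain ⟨σ, h1, h2⟩ : ∃ σ : Equiv.Perm W, (∀ w, σ w ≠ w) ∧ ∀ w, σ (σ w) ≠ w := by
    obtain ⟨n, hn⟩ : ∃ n, Fintype.card W = n + 3 := ⟨Fintype.card W - 3, by omega⟩
    let e := Fintype.equivFinOfCardEq hn
    have h2 : (1 + 1 : Fin (n + 3)) ≠ 0 := by
      intro h
      have := congrArg Fin.val h
      simp [Fin.val_add, Nat.mod_eq_of_lt (by omega : 2 < n + 3)] at this
    refine ⟨(e.trans (Equiv.addRight 1)).trans e.symm, fun w h => ?_, fun w h => ?_⟩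
    · simp [Equiv.symm_apply_eq] at h
    · have h3 : e w + 1 + 1 = e w := by simpa [Equiv.symm_apply_eq] using h
      rw [add_assoc] at h3
      exact h2 (add_eq_left.1 h3)
  -- A rotation has no short cycles; conjugating by this transposition, which fixes `x`, keeps that
  -- property and sends `x` to `y`.
  set τ := Equiv.swap (σ x) y
  have hτ : ∀ w, τ (τ w) = w := Equiv.swap_apply_self _ _
  have hx : τ x = x := Equiv.swap_apply_of_ne_of_ne (h1 x).symm hxy
  refine ⟨(τ.trans σ).trans τ, fun w h => ?_, fun w h => ?_, ?_⟩
  · simp only [Equiv.trans_apply] at h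
    exact h1 (τ w) (by rw [← hτ (σ (τ w)), h])
  · simp only [Equiv.trans_apply, hτ] at h
    exact h2 (τ w) (by rw [← hτ (σ (σ (τ w))), h])
  · simp only [Equiv.trans_apply, hx]
    exact Equiv.swap_apply_left _ _

/-- A proper edge coloring of `K₄` with three colors. -/
def completeMatchingColor : Fin 4 → Fin 4 → Fin 4 :=
  ![![3, 0, 1, 2], ![0, 3, 2, 1], ![1, 2, 3, 0], ![2, 1, 0, 3]]

/-- A proper edge coloring with four colors, in which two vertices miss the last color. -/
lemma exists_edgeColoring_missing {W : Type*} [Fintype W] {H : SimpleGraph W} (hH : H.DegLE 3)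
    (hW : 3 ≤ Fintype.card W) :
    ∃ χ : W → W → Fin 4, (∀ w w', χ w w' = χ w' w) ∧
      (∀ w w' w'', H.Adj w w' → H.Adj w w'' → w' ≠ w'' → χ w w' ≠ χ w w'') ∧
      ∃ z z', z ≠ z' ∧ (∀ w, H.Adj z w → χ z w ≠ 3) ∧ ∀ w, H.Adj z' w → χ z' w ≠ 3 := by
  classical
  rcases Nat.lt_or_ge 4 (Fintype.card W) with h4 | h4
  -- Only the matching property matters, so `f` is constant. The uncolored matching becomes the
  -- fourth color class.
  · obtain ⟨c, hc, hmatch, -⟩ := exists_partialEdgeColoring le_rfl hH fun _ => 0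
    set χ : W → W → Fin 4 := fun w w' => (c w w').elim 3 Fin.castSucc with hχ
    have hsymm : ∀ w w', χ w w' = χ w' w := fun w w' => by simp only [hχ, hc.symm w w']
    have h3 : ∀ d : Fin 3, d.castSucc ≠ (3 : Fin 4) := by decide
    have hproper : ∀ w w' w'', H.Adj w w' → H.Adj w w'' → w' ≠ w'' → χ w w' ≠ χ w w'' := by
      intro w w' w'' h h' hne
      simp only [hχ]
      cases h1 : c w w' with
      | none =>
        cases h2 : c w w'' with
        | none => exact (hne (hmatch w w' w'' h h1 h' h2)).elim
        | some d => exact (h3 d).symm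
      | some d =>
        cases h2 : c w w'' with
        | none => exact h3 d
        | some d' =>
          intro hd
          obtain rfl : d = d' := Fin.castSucc_injective 3 hd
          exact hne (hc.proper w w' w'' d h1 h2)
    have hmiss : ∀ w, ∃ q, ∀ w' ∈ Finset.univ.filter (H.Adj w), χ w w' ≠ q := fun w =>
      exists_color_avoiding (χ w) (Finset.univ.filter (H.Adj w))
        (Nat.lt_succ_of_le (hH w _ (by simp)))
    choose q hq using hmiss
    -- Each vertex misses one of four colors, so two of at least five vertices miss the same one,
    -- which is then renamed 3.
    obtain ⟨z, z', hne, hqz⟩ := Fintype.exists_ne_map_eq_of_card_lt q (by simpa using h4)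
    refine ⟨fun w w' => Equiv.swap (q z) 3 (χ w w'), fun w w' => by simp only [hsymm w w'],
      fun w w' w'' h h' hne' e => hproper w w' w'' h h' hne' ((Equiv.swap _ _).injective e),
      z, z', hne, fun w h e => ?_, fun w h e => ?_⟩
    · exact hq z w (by simpa using h)
        ((Equiv.swap (q z) 3).injective (e.trans (Equiv.swap_apply_left _ _).symm))
    · exact hq z' w (by simpa using h)
        (((Equiv.swap (q z) 3).injective (e.trans (Equiv.swap_apply_left _ _).symm)).trans hqz)
  · obtain ⟨i⟩ : Nonempty (W ↪ Fin 4) :=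
      Function.Embedding.nonempty_of_card_le (by simpa using h4)
    obtain ⟨z, z', hne⟩ := Fintype.exists_pair_of_one_lt_card (by omega : 1 < Fintype.card W)
    have h1 : ∀ x y, completeMatchingColor x y = completeMatchingColor y x := by decide
    have h2 : ∀ x y z, y ≠ z → completeMatchingColor x y ≠ completeMatchingColor x z := by decide
    have h3 : ∀ x y, x ≠ y → completeMatchingColor x y ≠ 3 := by decide
    exact ⟨fun w w' => completeMatchingColor (i w) (i w'), fun w w' => h1 _ _,
      fun w w' w'' _ _ hne => h2 _ _ _ (i.injective.ne hne), z, z', hne,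
      fun w h => h3 _ _ (i.injective.ne h.ne), fun w h => h3 _ _ (i.injective.ne h.ne)⟩

/-- Copies with at least three vertices. -/
lemma exists_isCopyColoring_of_three_le_card {W : Type*} [Fintype W] {H : SimpleGraph W}
    (hH : H.DegLE 3) (hW : 3 ≤ Fintype.card W) {k b : ℕ} {α : W → ℕ}
    (hα : Function.Injective α) (hα3 : ∀ w, 3 < α w ∧ α w ≤ k) (hb : ∀ w, b < α w) :
    ∃ hv he, H.IsCopyColoring k b α hv he := by
  classical
  obtain ⟨χ, hsymm, hproper, z, z', hzz', hz, hz'⟩ := exists_edgeColoring_missing hH hW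
  -- Here σ z' = z, and the last edge color becomes `α z`. That color is also on the vertex `z'` and
  -- on the pendant edge of `z`, and neither `z` nor `z'` meets an edge of the last color.
  obtain ⟨σ, hσ1, hσ2, hσ⟩ := exists_perm_without_short_cycles hW hzz'.symm
  set he : W → W → ℕ := fun w w' => if χ w w' = 3 then α z else (χ w w').val + 1 with hhe
  set cov : W → Prop := fun w => ∃ w', H.Adj w w' ∧ χ w w' = 3 with hcov
  have hncz : ¬ cov z := fun ⟨w, h, h'⟩ => hz w h h'
  have hncz' : ¬ cov z' := fun ⟨w, h, h'⟩ => hz' w h h'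
  have hlast : ∀ w w', H.Adj w w' → χ w w' = 3 → cov w ∧ cov w' := fun w w' h h' =>
    ⟨⟨w', h, h'⟩, ⟨w, h.symm, hsymm w w' ▸ h'⟩⟩
  have hσz : ∀ w, cov w → σ w ≠ z := by
    intro w hw h
    rw [← hσ] at h
    exact hncz' (σ.injective h ▸ hw)
  have hcz : ∀ w, cov w → w ≠ z := by
    rintro w hw rfl
    exact hncz hw
  have hsmall : ∀ w w' x, χ w w' ≠ 3 → (χ w w').val + 1 < α x := fun w w' x h => by
    have := hα3 x
    have : (χ w w').val ≠ 3 := fun e => h (Fin.ext e)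
    omega
  have hmem : ∀ w x, α x ∈ insert (α w) (H.seen (fun w => α (σ w)) he w) ↔
      x = w ∨ x = σ w ∨ x = z ∧ cov w := by
    intro w x
    constructor
    · rintro (h | h | ⟨w', hw', h⟩)
      · exact Or.inl (hα h)
      · exact Or.inr (Or.inl (hα h).symm)
      · by_cases h3 : χ w w' = 3
        · simp only [hhe, if_pos h3] at h
          exact Or.inr (Or.inr ⟨(hα h).symm, w', hw', h3⟩)
        · simp only [hhe, if_neg h3] at h
          exact absurd h (hsmall w w' x h3).ne
    · rintro (rfl | rfl | ⟨rfl, w', hw', h3⟩)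
      · exact Set.mem_insert _ _
      · exact Or.inr (Or.inl rfl)
      · exact Or.inr (Or.inr ⟨w', hw', by simp only [hhe, if_pos h3]⟩)
  refine ⟨fun w => α (σ w), he, ?_, ?_, ?_, ?_, ?_, ?_, ?_, ?_, ?_, ?_, ?_⟩
  · intro w w'
    simp only [hhe, hsymm w w']
  · intro w
    have := hα3 (σ w)
    exact ⟨by omega, this.2⟩
  · intro w w' _
    have := hα3 z
    simp only [hhe, Set.mem_Icc]
    split_ifs with h3
    · omega
    · have := hsmall w w' z h3
      omega
  · exact fun w => (hb (σ w)).ne'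
  · exact fun w h => hσ1 w (hα h)
  · intro w w' h
    simp only [hhe]
    split_ifs with h3
    · exact fun e => hcz w (hlast w w' h h3).1 (hα e).symm
    · exact (hsmall w w' w h3).ne
  · exact fun w w' h e => h.ne (σ.injective (hα e))
  · intro w w' h
    simp only [hhe]
    split_ifs with h3
    · exact fun e => hσz w (hlast w w' h h3).1 (hα e)
    · exact (hsmall w w' _ h3).ne'
  · intro w w' w'' h h' hne
    have hp := hproper w w' w'' h h' hne
    simp only [hhe]
    split_ifs with h1 h2 h2
    · exact (hp (h1.trans h2.symm)).elim
    · exact (hsmall w w'' z h2).ne'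
    · exact (hsmall w w' z h1).ne
    · exact fun e => hp (Fin.ext (by omega))
  -- Equal sets force w' = σ w and w = σ w', a 2-cycle, unless one vertex is `z` and the other meets
  -- an edge colored `α z`. In that case `z` sees only `α z` and `α (σ z)` from `range α`, which
  -- again gives a 2-cycle.
  · have key : ∀ w w', w ≠ w' → w = z → cov w' →
        insert (α w) (H.seen (fun w => α (σ w)) he w) ≠
          insert (α w') (H.seen (fun w => α (σ w)) he w') := by
      rintro w w' hne rfl hc heq
      have h1 := (hmem w w').1 (heq ▸ Set.mem_insert _ _)
      have h2 := (hmem w (σ w')).1 (heq ▸ (hmem w' (σ w')).2 (Or.inr (Or.inl rfl)))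
      have h3 : w' = σ w := by tauto
      rcases h2 with h2 | h2 | h2
      · exact hσ2 w (by rw [← h3, h2])
      · exact hne (σ.injective h2).symm
      · exact hncz h2.2
    intro w w' h heq
    have hne := h.ne
    have h1 := (hmem w w').1 (heq ▸ Set.mem_insert _ _)
    have h2 := (hmem w' w).1 (heq ▸ Set.mem_insert _ _)
    rcases h1 with h1 | h1 | h1
    · exact hne h1.symm
    · rcases h2 with h2 | h2 | h2
      · exact hne h2
      · exact hσ2 w (by rw [← h1, ← h2])
      · exact key w w' hne h2.1 h2.2 heq
    · exact key w' w hne.symm h1.1 h1.2 heq.symm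
  · intro w
    suffices h : ∃ x, ¬ (x = w ∨ x = σ w ∨ x = z ∧ cov w) by
      obtain ⟨x, hx⟩ := h
      exact ⟨α x, Or.inr ⟨x, rfl⟩, fun h => hx ((hmem w x).1 h)⟩
    -- If `w` meets an edge `ww'` of color `α z`, then w, w', z, z' are distinct, and `w'` or `z'`
    -- avoids w, σ w and z. Otherwise only w and σ w must be avoided.
    by_cases hc : cov w
    · obtain ⟨w', hw', h3⟩ := hc
      obtain ⟨hcw, hcw'⟩ := hlast w w' hw' h3
      have hw'z : w' ≠ z := hcz w' hcw'
      have hwz : w ≠ z := hcz w hcw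
      have hwz' : w ≠ z' := by rintro rfl; exact hncz' hcw
      have hw'z' : w' ≠ z' := by rintro rfl; exact hncz' hcw'
      by_cases hx : w' = σ w
      · exact ⟨z', by rw [← hx]; tauto⟩
      · exact ⟨w', by have := hw'.ne; tauto⟩
    · obtain ⟨x, -, hx⟩ := Finset.exists_mem_notMem_of_card_lt_card
        (s := ({w, σ w} : Finset W)) (t := Finset.univ)
        (Finset.card_le_two.trans_lt (by rw [Finset.card_univ]; omega))
      simp only [Finset.mem_insert, Finset.mem_singleton] at hx
      exact ⟨x, fun h => h.elim (fun h => hx (Or.inl h)) fun h =>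
        h.elim (fun h => hx (Or.inr h)) fun h => hc h.2⟩

lemma exists_isCopyColoring {W : Type*} [Fintype W] {H : SimpleGraph W} (hH : H.DegLE 3)
    {k b : ℕ} {α : W → ℕ} (hα : Function.Injective α) (hα3 : ∀ w, 3 < α w ∧ α w ≤ k)
    (hb : ∀ w, b < α w) : ∃ hv he, H.IsCopyColoring k b α hv he := by
  rcases Nat.lt_or_ge 2 (Fintype.card W) with h | h
  · exact exists_isCopyColoring_of_three_le_card hH h hα hα3 hb
  · exact exists_isCopyColoring_of_card_le_two H h hα hα3 hb

/-! ### Assembling the bound -/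

theorem exists_isDistinguishing_corona {V W : Type*} [Fintype V] [Fintype W] {G : SimpleGraph V}
    {H : SimpleGraph W} {D k : ℕ} (hD : D ≤ 3) (hG : G.DegLE D) (hH : H.DegLE 3)
    (hk : D + 3 + Fintype.card W ≤ k) : ∃ cv ce, (G.corona H).IsDistinguishing k cv ce := by
  obtain ⟨cv, ce, hcol⟩ := exists_isDistinguishing hD hG
  set e := Fintype.equivFin W
  -- The pendant colors are D + 4, …, D + 3 + |W|, just above those of `G`.
  set α : W → ℕ := fun w => D + 4 + e w with hα
  have hinj : Function.Injective α := fun w w' h =>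
    e.injective (Fin.ext (Nat.add_left_cancel h))
  have hαm : ∀ w, D + 3 < α w ∧ α w ≤ k := fun w => by
    have := (e w).2
    simp only [hα]
    omega
  have hex : ∀ v, ∃ hv he, H.IsCopyColoring k (cv v) α hv he := fun v =>
    exists_isCopyColoring hH hinj (fun w => ⟨by have := hαm w; omega, (hαm w).2⟩)
      fun w => by
        have := hαm w
        have := (hcol.vertex_mem v).2
        omega
  choose hv he hcopy using hex
  exact ⟨_, _, hcol.corona (by omega) hinj hαm hcopy⟩

lemma degLE_of_maxDegree_le {V : Type*} [Fintype V] {G : SimpleGraph V} [DecidableRel G.Adj]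
    {d : ℕ} (h : G.maxDegree ≤ d) : G.DegLE d := by
  intro v T hT
  refine le_trans ?_ ((G.degree_le_maxDegree v).trans h)
  exact Finset.card_le_card fun w hw => (G.mem_neighborFinset v w).2 (hT w hw)

lemma maxDegree_add_card_le_maxDegree_corona {V W : Type*} [Fintype V] [Fintype W] [Nonempty V]
    (G : SimpleGraph V) (H : SimpleGraph W) [DecidableRel G.Adj]
    [DecidableRel (G.corona H).Adj] :
    G.maxDegree + Fintype.card W ≤ (G.corona H).maxDegree := by
  obtain ⟨v, hv⟩ := G.exists_maximal_degree_vertex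
  refine le_trans ?_ ((G.corona H).degree_le_maxDegree (Sum.inl v))
  rw [hv, ← card_neighborFinset_eq_degree, ← Finset.card_univ, ← Finset.card_disjSum,
    ← Finset.card_map ((Function.Embedding.refl V).sumMap
      ⟨fun w : W => (v, w), fun w w' h => (Prod.mk.inj h).2⟩)]
  refine Finset.card_le_card fun x hx => ?_
  rw [mem_neighborFinset]
  obtain ⟨y | w, hy, rfl⟩ := Finset.mem_map.1 hx
  · exact (G.mem_neighborFinset v y).1 (Finset.inl_mem_disjSum.1 hy)
  · exact rfl

end SimpleGraph

theorem corollary1 {V W : Type*} [Fintype V] [Fintype W]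
    (G : SimpleGraph V) (H : SimpleGraph W)
    [DecidableRel G.Adj] [DecidableRel H.Adj] [DecidableRel (G.corona H).Adj]
    (hG : G.IsSubcubic) (hH : H.IsSubcubic) :
    (G.corona H).tndi ≤ (((G.corona H).maxDegree + 3 : ℕ) : ℕ∞) := by
  suffices h : ∃ cv ce, (G.corona H).IsDistinguishing ((G.corona H).maxDegree + 3) cv ce by
    obtain ⟨cv, ce, h⟩ := h
    exact iInf₂_le _ ⟨Nat.succ_pos _, h.exists_isNeighborSetDistinguishing⟩
  -- Without vertices in `G` the corona is empty, and the bound on its maximum degree can fail when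
  -- `H` is nonempty; any coloring works then.
  rcases isEmpty_or_nonempty V with hV | hV
  · have : IsEmpty (V ⊕ V × W) := inferInstance
    refine ⟨fun _ => 1, fun _ _ => 1, ?_, ?_, ?_, ?_, ?_, ?_, ?_⟩ <;> exact fun v => this.elim v
  · refine SimpleGraph.exists_isDistinguishing_corona hG (SimpleGraph.degLE_of_maxDegree_le le_rfl)
      (SimpleGraph.degLE_of_maxDegree_le hH) ?_
    have := G.maxDegree_add_card_le_maxDegree_corona H
    omega
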